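/- Let $\mathbb F\in\{\mathbb R,\mathbb C\}$, let $X$ be a locally compact Hausdorff space, and let $C_0(X)=C_0(X,\mathbb F)$ be the Banach algebra of continuous $\mathbb F$-valued functions on $X$ vanishing at infinity, with the supremum norm. A \emph{representation} of a Banach algebra $A$ in a Banach algebra $B$ is a contractive algebra homomorphism $\pi:A\to B$; if $B=B(E)$ is the algebra of bounded operators on a Banach space $E$, then $\pi$ is \emph{non-degenerate} if $\overline{\operatorname{span}}\,\pi(A)E=E$. A measure $\mu$ on a measurable space $(\Omega,\Sigma)$ is \emph{localizable} if it is semi-finite and the Boolean algebra of measurable sets modulo $\mu$-null sets is Dedekind complete. Let $\pi:C_0(X)\to B(E)$ be a non-degenerate representation, where either $E=L^p(\mu)=L^p(\mu,\mathbb F)$ for a localizable measure $\mu$ and $p\in[1,\infty]\setminus\{2\}$, or $E=C_0(\Omega)=C_0(\Omega,\mathbb F)$ for a locally compact Hausdorff space $\Omega$. Call $\pi$ \emph{positive} if for every $a\in C_0(X)$ with $a\ge 0$ the operator $\pi(a)$ maps non-negative functions in $E$ to non-negative functions. (1) If $\mathbb F=\mathbb C$, then $\pi$ is positive. (2) If $\pi$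 is positive (with $\mathbb F=\mathbb R$ or $\mathbb F=\mathbb C$), then $\pi$ is given by multiplication operators: there is a representation $\pi_0:C_0(X)\to L^\infty(\mu)$ if $E=L^p(\mu)$, or $\pi_0:C_0(X)\to C_b(\Omega)$ (the bounded continuous functions) if $E=C_0(\Omega)$, such that \[ [\pi(a)\xi](x)=\pi_0(a)(x)\,\xi(x),\qquad a\in C_0(X),\ \xi\in E, \] for $\mu$-almost every $x$ if $E=L^p(\mu)$, and for every $x\in\Omega$ if $E=C_0(\Omega)$. -/

import Mathlib

open MeasureTheory
open scoped ENNReal ZeroAtInfty BoundedContinuousFunction ComplexOrder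

/-- A measure is localizable if it is semi-finite and the Boolean algebra of measurable sets modulo
null sets is Dedekind complete. The second condition is spelled out on representatives: every
family of measurable sets has a supremum for inclusion up to null sets. -/
structure IsLocalizable {Ω : Type*} [MeasurableSpace Ω] (μ : Measure Ω) : Prop where
  semifinite : ∀ s : Set Ω, MeasurableSet s → μ s = ∞ →
    ∃ t : Set Ω, t ⊆ s ∧ MeasurableSet t ∧ 0 < μ t ∧ μ t < ∞
  exists_essSup : ∀ 𝒜 : Set (Set Ω), (∀ A ∈ 𝒜, MeasurableSet A) →
    ∃ S : Set Ω, MeasurableSet S ∧ (∀ A ∈ 𝒜, μ (A \ S) = 0) ∧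
      ∀ T : Set Ω, MeasurableSet T → (∀ A ∈ 𝒜, μ (A \ T) = 0) → μ (S \ T) = 0

/-- A map between normed spaces is contractive if it does not increase norms. A representation of a
Banach algebra is a contractive algebra homomorphism. -/
def IsContractive {A B : Type*} [Norm A] [Norm B] (π : A → B) : Prop :=
  ∀ a : A, ‖π a‖ ≤ ‖a‖

/-- Non-degeneracy of a family of operators `π : A → B(E)`: the closed linear span of `π(A)E`
is `E`. -/
def IsNondegenerate {𝕜 A E : Type*} [RCLike 𝕜] [NormedAddCommGroup E] [NormedSpace 𝕜 E]
    (π : A → (E →L[𝕜] E)) : Prop :=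
  (Submodule.span 𝕜 {η : E | ∃ (a : A) (ξ : E), η = π a ξ}).topologicalClosure = ⊤

/-- An operator on `L^p(μ)` is positive if it preserves (a.e.) non-negative functions. In the
complex case, `0 ≤ z` means that `z` is real and non-negative. -/
def IsPositiveOnLp {𝕜 Ω : Type*} [RCLike 𝕜] [MeasurableSpace Ω] {μ : Measure Ω} {p : ℝ≥0∞}
    [Fact (1 ≤ p)] (T : Lp 𝕜 p μ →L[𝕜] Lp 𝕜 p μ) : Prop :=
  ∀ ξ : Lp 𝕜 p μ, (∀ᵐ x ∂μ, 0 ≤ ξ x) → ∀ᵐ x ∂μ, 0 ≤ (T ξ) x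

/-- An operator on `C_0(Ω)` is positive if it preserves non-negative functions. -/
def IsPositiveOnC0 {𝕜 Ω : Type*} [RCLike 𝕜] [TopologicalSpace Ω]
    (T : C₀(Ω, 𝕜) →L[𝕜] C₀(Ω, 𝕜)) : Prop :=
  ∀ ξ : C₀(Ω, 𝕜), (∀ x, 0 ≤ ξ x) → ∀ x, 0 ≤ (T ξ) x

section

open Filter Topology

/-! ### Approximate units and the extension of a representation to `a + c` -/

section ApproximateUnit

variable {𝕜 : Type*} [RCLike 𝕜] {X : Type*} [TopologicalSpace X]

/-! Non-degeneracy makes `π (e K)` tend strongly to the identity along an approximate unit, so `π`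
extends contractively to functions `a + c` with `c` constant (`norm_representation_add_smul_le`).
Everything else rests on this extension and on locality: `T ξ` vanishes wherever `ξ` does.

Over `ℂ`, a real function `a` satisfies `|1 + ita| ≤ 1 + O(t²)`, hence `‖1 + itπ(a)‖ ≤ 1 + O(t²)`:
the operator is Hermitian. Hermitian operators on `L^p` with `p ≠ 2`, or on `C₀`, are local. For
finite `p` one pairs `T f` with the duality map of `f`; this map is additive on disjoint supports
but, when `p ≠ 2`, does not scale linearly, which kills the cross terms. On `L^∞` and `C₀` one
perturbs a function equal to its maximum `1` on the zero set, or at the zero, of `ξ`. Locality turns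
operator norm bounds into pointwise ones (`IsLocalOnLp.ae_norm_le`), so for `a ≥ 0` the bounds for
all `a + c` confine the multiplier of `π a` to a family of discs through `0` and `‖a‖`. They meet
only in the segment `[0, ‖a‖]`, whence positivity.

If `π` is positive, over either field, then `0 ≤ π a ≤ ‖a‖` for `a ≥ 0`. Splitting functions into
non-negative parts gives pointwise domination for all `a` and `ξ`, hence locality. A dominated
operator is multiplication by its value on functions equal to `1` locally: indicators glued by
localizability for `L^p`, Urysohn bumps for `C₀`. -/

lemma ZeroAtInftyContinuousMap.norm_apply_le (f : C₀(X, 𝕜)) (x : X) : ‖f x‖ ≤ ‖f‖ :=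
  f.toBCF.norm_coe_le_norm x

lemma ZeroAtInftyContinuousMap.norm_le_of_forall {f : C₀(X, 𝕜)} {r : ℝ} (hr : 0 ≤ r)
    (h : ∀ x, ‖f x‖ ≤ r) : ‖f‖ ≤ r :=
  (BoundedContinuousFunction.norm_le (f := f.toBCF) hr).2 h

variable (𝕜)

/-- Urysohn's lemma for functions vanishing at infinity. -/
lemma exists_zeroAtInfty_bump [LocallyCompactSpace X] [T2Space X] {K U : Set X}
    (hK : IsCompact K) (hU : IsOpen U) (hKU : K ⊆ U) :
    ∃ g : C₀(X, 𝕜), (∀ x ∈ K, g x = 1) ∧ (∀ x ∉ U, g x = 0) ∧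
      ∀ x, 0 ≤ g x ∧ ‖g x‖ ≤ 1 := by
  obtain ⟨f, hf1, hf0, hfc, hf⟩ := exists_continuous_one_zero_of_isCompact hK hU.isClosed_compl
    (Set.disjoint_compl_right_iff_subset.2 hKU)
  refine ⟨⟨⟨fun x => (f x : 𝕜), by fun_prop⟩, ?_⟩, fun x hx => ?_, fun x hx => ?_, fun x => ?_⟩
  · have h := (hfc.comp_left (g := fun r : ℝ => (r : 𝕜)) (by simp)).is_zero_at_infty
    exact h
  · simp [hf1 hx]
  · simp [hf0 (show x ∈ Uᶜ from hx)]
  · refine ⟨?_, ?_⟩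
    · simpa using (hf x).1
    · simpa [abs_of_nonneg (hf x).1] using (hf x).2

/-- `C₀(X)` has an approximate unit consisting of functions with values in `[0, 1]`. -/
lemma exists_zeroAtInfty_approximateUnit [LocallyCompactSpace X] [T2Space X] :
    ∃ e : TopologicalSpace.Compacts X → C₀(X, 𝕜), (∀ K x, 0 ≤ e K x ∧ ‖e K x‖ ≤ 1) ∧
      ∀ b : C₀(X, 𝕜), Tendsto (fun K => e K * b) atTop (𝓝 b) := by
  choose e he1 _ he using fun K : TopologicalSpace.Compacts X =>
    exists_zeroAtInfty_bump 𝕜 K.isCompact isOpen_univ (Set.subset_univ _)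
  refine ⟨e, he, fun b => ?_⟩
  rw [Metric.tendsto_atTop]
  intro ε hε
  have hb := (b.zero_at_infty').eventually (Metric.ball_mem_nhds 0 (show 0 < ε / 4 by positivity))
  rw [Filter.eventually_iff, mem_cocompact] at hb
  obtain ⟨K, hK, hKb⟩ := hb
  refine ⟨⟨K, hK⟩, fun L hL => ?_⟩
  rw [dist_eq_norm]
  refine lt_of_le_of_lt (ZeroAtInftyContinuousMap.norm_le_of_forall
    (show 0 ≤ ε / 2 by positivity) fun x => ?_) (by linarith)
  by_cases hx : x ∈ K
  · have : e L x = 1 := he1 L x (hL hx)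
    simpa [this] using (half_pos hε).le
  · have h1 : ‖b x‖ < ε / 4 := by simpa using hKb hx
    calc ‖(e L * b - b) x‖ ≤ ‖e L x‖ * ‖b x‖ + ‖b x‖ := by
          simpa using norm_sub_le (e L x * b x) (b x)
      _ ≤ 1 * ‖b x‖ + ‖b x‖ := by gcongr; exact (he L x).2
      _ ≤ ε / 2 := by linarith

variable {𝕜}

/-- Along an approximate unit, a contractive non-degenerate representation converges strongly to
the identity. -/
lemma tendsto_representation_approximateUnit {E : Type*} [NormedAddCommGroup E] [NormedSpace 𝕜 E]
    {π : C₀(X, 𝕜) →ₙₐ[𝕜] (E →L[𝕜] E)} (hπ : IsContractive π) (hnd : IsNondegenerate π)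
    {ι : Type*} {l : Filter ι} {e : ι → C₀(X, 𝕜)} (he : ∀ i x, ‖e i x‖ ≤ 1)
    (hlim : ∀ b : C₀(X, 𝕜), Tendsto (fun i => e i * b) l (𝓝 b)) (ξ : E) :
    Tendsto (fun i => π (e i) ξ) l (𝓝 ξ) := by
  have hcontr : ∀ i (ζ : E), ‖π (e i) ζ‖ ≤ ‖ζ‖ := fun i ζ => by
    have h1 : ‖π (e i)‖ ≤ 1 :=
      (hπ _).trans (ZeroAtInftyContinuousMap.norm_le_of_forall zero_le_one (he i))
    simpa using (π (e i)).le_of_opNorm_le h1 ζ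
  have hπc : Continuous π := by
    refine AddMonoidHomClass.continuous_of_bound π 1 fun a => ?_
    simpa using hπ a
  have hspan : ∀ ζ ∈ Submodule.span 𝕜 {η : E | ∃ (a : C₀(X, 𝕜)) (ξ : E), η = π a ξ},
      Tendsto (fun i => π (e i) ζ) l (𝓝 ζ) := by
    intro ζ hζ
    induction hζ using Submodule.span_induction with
    | mem x hx =>
      obtain ⟨a, η, rfl⟩ := hx
      have h : Tendsto (fun i => π (e i * a) η) l (𝓝 (π a η)) :=
        (((ContinuousLinearMap.apply 𝕜 E η).continuous.comp hπc).tendsto a).comp (hlim a)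
      simpa [map_mul] using h
    | zero => simpa using tendsto_const_nhds
    | add x y _ _ hx hy => simpa using hx.add hy
    | smul c x _ hx => simpa using hx.const_smul c
  rw [Metric.tendsto_nhds]
  intro ε hε
  have hmem : ξ ∈ closure (Submodule.span 𝕜
      {η : E | ∃ (a : C₀(X, 𝕜)) (ξ : E), η = π a ξ} : Set E) := by
    rw [← Submodule.topologicalClosure_coe, hnd]; trivial
  obtain ⟨ζ, hζ, hd⟩ := Metric.mem_closure_iff.1 hmem (ε / 3) (by positivity)
  filter_upwards [(Metric.tendsto_nhds.1 (hspan ζ hζ)) (ε / 3) (by positivity)] with i hi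
  calc dist (π (e i) ξ) ξ ≤ dist (π (e i) ξ) (π (e i) ζ) + dist (π (e i) ζ) ζ + dist ζ ξ :=
        dist_triangle4 _ _ _ _
    _ ≤ dist ξ ζ + dist (π (e i) ζ) ζ + dist ζ ξ := by
        gcongr
        rw [dist_eq_norm, dist_eq_norm, ← map_sub]
        exact hcontr i _
    _ < ε := by rw [dist_comm ζ ξ]; linarith

/-- The extension of a non-degenerate representation of `C₀(X)` to the functions `a + c` with `c`
a constant is contractive. -/
lemma norm_representation_add_smul_le [LocallyCompactSpace X] [T2Space X]
    {E : Type*} [NormedAddCommGroup E] [NormedSpace 𝕜 E]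
    {π : C₀(X, 𝕜) →ₙₐ[𝕜] (E →L[𝕜] E)} (hπ : IsContractive π) (hnd : IsNondegenerate π)
    {a : C₀(X, 𝕜)} {c : 𝕜} {r : ℝ} (hr : 0 ≤ r) (h : ∀ x, ‖a x + c‖ ≤ r) (ξ : E) :
    ‖π a ξ + c • ξ‖ ≤ r * ‖ξ‖ := by
  obtain ⟨e, he, hlim⟩ := exists_zeroAtInfty_approximateUnit 𝕜 (X := X)
  have ht := tendsto_representation_approximateUnit hπ hnd (fun K x => (he K x).2) hlim
  -- The operator `π a + c` is the strong limit of `π` at `e K * (a + c)`, which lies in `C₀(X)` and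
  -- has norm at most `r`.
  have hl : Tendsto (fun K => π (e K * a + c • e K) ξ) atTop (𝓝 (π a ξ + c • ξ)) := by
    simpa using (ht (π a ξ)).add ((ht ξ).const_smul c)
  refine le_of_tendsto hl.norm (Eventually.of_forall fun K => ?_)
  refine (π _).le_of_opNorm_le ((hπ _).trans ?_) ξ
  refine ZeroAtInftyContinuousMap.norm_le_of_forall hr fun x => ?_
  have : (e K * a + c • e K) x = e K x * (a x + c) := by simp; ring
  rw [this, norm_mul]
  calc ‖e K x‖ * ‖a x + c‖ ≤ 1 * r := by gcongr; exacts [(he K x).2, h x]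
    _ = r := one_mul r

/-- Representations send real functions to Hermitian operators. -/
lemma norm_add_smul_representation_le [LocallyCompactSpace X] [T2Space X]
    {E : Type*} [NormedAddCommGroup E] [NormedSpace ℂ E]
    {π : C₀(X, ℂ) →ₙₐ[ℂ] (E →L[ℂ] E)} (hπ : IsContractive π) (hnd : IsNondegenerate π)
    {a : C₀(X, ℂ)} (ha : ∀ x, (a x).im = 0) (t : ℝ) (ξ : E) :
    ‖ξ + ((t : ℂ) * Complex.I) • π a ξ‖ ≤ (1 + t ^ 2 * ‖a‖ ^ 2) * ‖ξ‖ := by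
  have h := norm_representation_add_smul_le hπ hnd (a := ((t : ℂ) * Complex.I) • a) (c := 1)
    (r := 1 + t ^ 2 * ‖a‖ ^ 2) (by positivity) (fun x => ?_) ξ
  · simpa [add_comm] using h
  · have hle : (a x).re ^ 2 ≤ ‖a‖ ^ 2 := by
      rw [← sq_abs]
      exact pow_le_pow_left₀ (abs_nonneg _) ((Complex.abs_re_le_norm _).trans
        (a.norm_apply_le x)) 2
    have h0 : 0 ≤ t ^ 2 * ‖a‖ ^ 2 := by positivity
    refine abs_le_of_sq_le_sq' ?_ (by positivity) |>.2
    rw [← Complex.normSq_eq_norm_sq, Complex.normSq_apply]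
    simp [ha x]
    nlinarith [mul_le_mul_of_nonneg_left hle (sq_nonneg t)]

end ApproximateUnit

/-! ### Local operators on `L^p` and gluing of their multipliers -/

section MultiplicationOperators

variable {𝕜 : Type*} [RCLike 𝕜] {Ω : Type*} [MeasurableSpace Ω] {μ : Measure Ω} {p : ℝ≥0∞}
  [Fact (1 ≤ p)]

/-- An operator on `L^p` is local if it does not enlarge supports. -/
def IsLocalOnLp (T : Lp 𝕜 p μ →L[𝕜] Lp 𝕜 p μ) : Prop :=
  ∀ ξ : Lp 𝕜 p μ, ∀ᵐ x ∂μ, ξ x = 0 → T ξ x = 0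

/-- A local operator is dominated pointwise by its norm. -/
lemma IsLocalOnLp.ae_norm_le {T : Lp 𝕜 p μ →L[𝕜] Lp 𝕜 p μ} (hT : IsLocalOnLp T) {C : ℝ}
    (hC : 0 ≤ C) (hTC : ∀ ξ, ‖T ξ‖ ≤ C * ‖ξ‖) (ξ : Lp 𝕜 p μ) :
    ∀ᵐ x ∂μ, ‖T ξ x‖ ≤ C * ‖ξ x‖ := by
  -- On the set `A` where `|ξ| ≤ ε` and `|T ξ| > δ`, locality lets `ξ` be replaced by its
  -- restriction to `A`. Then `δ ‖1_A‖ ≤ C ε ‖1_A‖`, so `A` is null. Rational `ε`, `δ` leave only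
  -- countably many null sets.
  have key : ∀ ε δ : ℚ, 0 < ε → C * ε < δ → ∀ᵐ x ∂μ, ‖ξ x‖ ≤ ε → ‖T ξ x‖ ≤ δ := by
    intro ε δ hε hδ
    have hε' : (0 : ℝ) < ε := by exact_mod_cast hε
    have hδ' : (0 : ℝ) < δ := lt_of_le_of_lt (by positivity) hδ
    set A : Set Ω := {x | ‖ξ x‖ ≤ ε} ∩ {x | (δ : ℝ) < ‖T ξ x‖} with hA
    have hAm : MeasurableSet A :=
      ((Lp.stronglyMeasurable ξ).norm.measurable measurableSet_Iic).inter
        ((Lp.stronglyMeasurable (T ξ)).norm.measurable measurableSet_Ioi)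
    have hχ : MemLp (A.indicator fun _ => (1 : 𝕜)) p μ := by
      refine (Lp.memLp (T ξ)).of_le_mul (c := (δ : ℝ)⁻¹)
        (aestronglyMeasurable_const.indicator hAm) (Eventually.of_forall fun x => ?_)
      by_cases hx : x ∈ A
      · rw [Set.indicator_of_mem hx, norm_one, ← div_eq_inv_mul, one_le_div hδ']
        exact hx.2.le
      · rw [Set.indicator_of_notMem hx, norm_zero]
        positivity
    have hζ : MemLp (A.indicator ξ) p μ := (Lp.memLp ξ).indicator hAm
    have hloc := hT (ξ - hζ.toLp)
    rw [map_sub] at hloc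
    have h1 : ‖hχ.toLp‖ ≤ (δ : ℝ)⁻¹ * ‖T hζ.toLp‖ := by
      refine Lp.norm_le_mul_norm_of_ae_le_mul ?_
      filter_upwards [hχ.coeFn_toLp, hζ.coeFn_toLp, hloc, Lp.coeFn_sub ξ hζ.toLp,
        Lp.coeFn_sub (T ξ) (T hζ.toLp)] with x h1 h2 h3 h4 h5
      rw [h1]
      by_cases hx : x ∈ A
      · rw [h4, h5, Pi.sub_apply, Pi.sub_apply, h2, Set.indicator_of_mem hx, sub_self] at h3
        rw [Set.indicator_of_mem hx, norm_one, ← div_eq_inv_mul, one_le_div hδ',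
          ← sub_eq_zero.1 (h3 rfl)]
        exact hx.2.le
      · rw [Set.indicator_of_notMem hx, norm_zero]
        positivity
    have h2 : ‖hζ.toLp‖ ≤ ε * ‖hχ.toLp‖ := by
      refine Lp.norm_le_mul_norm_of_ae_le_mul ?_
      filter_upwards [hχ.coeFn_toLp, hζ.coeFn_toLp] with x h1 h2
      rw [h1, h2]
      by_cases hx : x ∈ A
      · simpa [hx] using hx.1
      · simp [hx]
    have h3 : ‖hχ.toLp‖ = 0 := by
      have h4 : δ * ‖hχ.toLp‖ ≤ C * ε * ‖hχ.toLp‖ :=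
        calc δ * ‖hχ.toLp‖ ≤ δ * ((δ : ℝ)⁻¹ * ‖T hζ.toLp‖) := by gcongr
          _ = ‖T hζ.toLp‖ := by field_simp
          _ ≤ C * ‖hζ.toLp‖ := hTC _
          _ ≤ C * (ε * ‖hχ.toLp‖) := by gcongr
          _ = _ := by ring
      have h5 : 0 ≤ ‖hχ.toLp‖ := norm_nonneg _
      by_contra hne
      have h6 : 0 < ‖hχ.toLp‖ := lt_of_le_of_ne h5 (Ne.symm hne)
      exact absurd (le_of_mul_le_mul_right h4 h6) (not_le.2 hδ)
    have h4 := (Lp.eq_zero_iff_ae_eq_zero).1 (norm_eq_zero.1 h3)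
    filter_upwards [h4, hχ.coeFn_toLp] with x h5 h6 hxε
    by_contra hlt
    have hx : x ∈ A := ⟨hxε, not_le.1 hlt⟩
    rw [h6, Set.indicator_of_mem hx] at h5
    exact one_ne_zero h5
  have hall : ∀ᵐ x ∂μ, ∀ ε δ : ℚ, 0 < ε → C * ε < δ → ‖ξ x‖ ≤ ε → ‖T ξ x‖ ≤ δ := by
    simp only [ae_all_iff]
    exact key
  filter_upwards [hall] with x hx
  by_contra! hlt
  -- Dividing by `C + 1` allows `C = 0` and still keeps `C * ε` below `‖T ξ x‖`.
  obtain ⟨ε, hε1, hε2⟩ := exists_rat_btwn (show ‖ξ x‖ < ‖ξ x‖ + (‖T ξ x‖ - C * ‖ξ x‖) / (C + 1) by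
    have : 0 < (‖T ξ x‖ - C * ‖ξ x‖) / (C + 1) := div_pos (by linarith) (by linarith)
    linarith)
  have hCε : C * ε < ‖T ξ x‖ := by
    have h1 : (ε - ‖ξ x‖) * (C + 1) < ‖T ξ x‖ - C * ‖ξ x‖ := by
      rw [← lt_div_iff₀ (by linarith)]; linarith
    nlinarith
  obtain ⟨δ, hδ1, hδ2⟩ := exists_rat_btwn hCε
  exact absurd (hx ε δ (by exact_mod_cast (norm_nonneg _).trans_lt hε1) hδ1 hε1.le)
    (not_le.2 hδ2)

/-- Pointwise dominated operators are symmetric for the pointwise product. -/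
lemma ae_mul_eq_mul_of_ae_norm_le {T : Lp 𝕜 p μ →L[𝕜] Lp 𝕜 p μ} {C : ℝ}
    (hT : ∀ ξ : Lp 𝕜 p μ, ∀ᵐ x ∂μ, ‖T ξ x‖ ≤ C * ‖ξ x‖) (ξ η : Lp 𝕜 p μ) :
    ∀ᵐ x ∂μ, T ξ x * η x = ξ x * T η x := by
  -- Domination applied to `ξ - c • η` for a countable dense set of `c` holds off one null set,
  -- hence there for all `c` by continuity. The choice `c = ξ x / η x` makes the right side vanish.
  have hseq : ∀ᵐ x ∂μ, ∀ n : ℕ, ‖T ξ x - TopologicalSpace.denseSeq 𝕜 n * T η x‖ ≤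
      C * ‖ξ x - TopologicalSpace.denseSeq 𝕜 n * η x‖ := by
    rw [ae_all_iff]
    intro n
    have h := hT (ξ - TopologicalSpace.denseSeq 𝕜 n • η)
    rw [map_sub, map_smul] at h
    filter_upwards [h, Lp.coeFn_sub ξ (TopologicalSpace.denseSeq 𝕜 n • η),
      Lp.coeFn_sub (T ξ) (TopologicalSpace.denseSeq 𝕜 n • T η),
      Lp.coeFn_smul (TopologicalSpace.denseSeq 𝕜 n) η,
      Lp.coeFn_smul (TopologicalSpace.denseSeq 𝕜 n) (T η)] with x h1 h2 h3 h4 h5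
    rw [h2, h3, Pi.sub_apply, Pi.sub_apply, h4, h5] at h1
    exact h1
  filter_upwards [hseq, hT η] with x hx hη
  have hall : ∀ c : 𝕜, ‖T ξ x - c * T η x‖ ≤ C * ‖ξ x - c * η x‖ := by
    intro c
    refine (TopologicalSpace.denseRange_denseSeq 𝕜).induction_on
      (p := fun c => ‖T ξ x - c * T η x‖ ≤ C * ‖ξ x - c * η x‖) c ?_ hx
    exact isClosed_le (by fun_prop) (by fun_prop)
  by_cases h0 : η x = 0
  · rw [h0, norm_zero, mul_zero, norm_le_zero_iff] at hη
    simp [h0, hη]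
  · have h := hall (ξ x / η x)
    rw [div_mul_cancel₀ _ h0, sub_self, norm_zero, mul_zero, norm_le_zero_iff, sub_eq_zero] at h
    rw [h]
    field_simp

/-- Semi-finiteness reduces nullity to sets of finite measure, whose indicators lie in `L^p` and
serve as test functions. -/
lemma IsLocalizable.measure_eq_zero (hμ : IsLocalizable μ) {N : Set Ω} (hN : MeasurableSet N)
    (h : ∀ A : Set Ω, MeasurableSet A → μ A < ∞ → μ (N ∩ A) = 0) : μ N = 0 := by
  by_contra h0
  rcases lt_or_eq_of_le (le_top : μ N ≤ ∞) with hlt | heq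
  · exact h0 (by simpa using h N hN hlt)
  · obtain ⟨t, htN, htm, ht0, htfin⟩ := hμ.semifinite N hN heq
    have := h t htm htfin
    rw [Set.inter_eq_self_of_subset_right htN] at this
    exact ht0.ne' this

/-- For a localizable measure, compatible families of measurable functions can be glued. -/
lemma IsLocalizable.exists_glue (hμ : IsLocalizable μ) {ι : Type*} {A : ι → Set Ω}
    (hA : ∀ i, MeasurableSet (A i)) {h : ι → Ω → ℝ≥0∞} (hh : ∀ i, Measurable (h i))
    (hcomp : ∀ i j, ∀ᵐ x ∂μ, x ∈ A i → x ∈ A j → h i x = h j x) :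
    ∃ H : Ω → ℝ≥0∞, Measurable H ∧ ∀ i, ∀ᵐ x ∂μ, x ∈ A i → H x = h i x := by
  -- The function is rebuilt from superlevel sets at a dense sequence of levels; `S n` is the
  -- essential supremum of the local superlevel sets at level `q n`.
  set q : ℕ → ℝ≥0∞ := TopologicalSpace.denseSeq ℝ≥0∞ with hq
  have hm : ∀ n i, MeasurableSet (A i ∩ {x | q n < h i x}) := fun n i =>
    (hA i).inter (hh i measurableSet_Ioi)
  choose S hSm hS hSmin using fun n => hμ.exists_essSup
    (Set.range fun i => A i ∩ {x | q n < h i x}) (by rintro _ ⟨i, rfl⟩; exact hm n i)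
  have hmem : ∀ i, ∀ᵐ x ∂μ, ∀ n, x ∈ A i → (x ∈ S n ↔ q n < h i x) := by
    intro i
    rw [ae_all_iff]
    intro n
    have h1 : ∀ᵐ x ∂μ, x ∈ A i → q n < h i x → x ∈ S n := by
      rw [ae_iff]
      refine measure_mono_null ?_ (hS n _ ⟨i, rfl⟩)
      intro x hx
      simp only [Set.mem_ofPred_eq, Classical.not_imp] at hx
      exact ⟨⟨hx.1, hx.2.1⟩, hx.2.2⟩
    have h2 : ∀ᵐ x ∂μ, x ∈ A i → x ∈ S n → q n < h i x := by
      -- By compatibility, removing from `S n` the part of `A i` where `h i ≤ q n` still leaves an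
      -- upper bound, so minimality makes the removed part null.
      have h3 := hSmin n (S n \ (A i \ {x | q n < h i x}))
        ((hSm n).diff ((hA i).diff (hh i measurableSet_Ioi))) (by
          rintro _ ⟨j, rfl⟩
          refine measure_mono_null (t := ((A j ∩ {x | q n < h j x}) \ S n) ∪
            {x | ¬ (x ∈ A i → x ∈ A j → h i x = h j x)}) ?_
            (measure_union_null (hS n _ ⟨j, rfl⟩) (ae_iff.1 (hcomp i j)))
          rintro x ⟨⟨hxj, hxq⟩, hx⟩
          by_cases hxS : x ∈ S n
          · right
            simp only [Set.mem_sdiff, hxS, true_and, not_not, Set.mem_ofPred_eq] at hx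
            intro heq
            exact hx.2 (by rw [heq hx.1 hxj]; exact hxq)
          · exact Or.inl ⟨⟨hxj, hxq⟩, hxS⟩)
      rw [ae_iff]
      refine measure_mono_null ?_ h3
      intro x hx
      simp only [Set.mem_ofPred_eq, Classical.not_imp] at hx
      exact ⟨hx.2.1, fun hx' => hx'.2 ⟨hx.1, hx.2.2⟩⟩
    filter_upwards [h1, h2] with x h3 h4 hx
    exact ⟨h4 hx, h3 hx⟩
  refine ⟨fun x => ⨆ n, (S n).indicator (fun _ => q n) x,
    Measurable.iSup fun n => measurable_const.indicator (hSm n), fun i => ?_⟩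
  filter_upwards [hmem i] with x hx hxA
  apply le_antisymm
  · refine iSup_le fun n => ?_
    by_cases hxn : x ∈ S n
    · rw [Set.indicator_of_mem hxn]
      exact ((hx n hxA).1 hxn).le
    · simp [hxn]
  · refine le_of_forall_lt fun b hb => ?_
    obtain ⟨_, ⟨n, rfl⟩, hn1, hn2⟩ :=
      (TopologicalSpace.denseRange_denseSeq ℝ≥0∞).exists_between hb
    refine hn1.trans_le (le_iSup_of_le n ?_)
    rw [Set.indicator_of_mem ((hx n hxA).2 hn2)]

/-- The positive part of the real part. -/
def posRe (z : 𝕜) : 𝕜 := ((max (RCLike.re z) 0 : ℝ) : 𝕜)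

lemma posRe_nonneg (z : 𝕜) : 0 ≤ posRe z := by
  simp [posRe]

lemma posRe_zero : posRe (0 : 𝕜) = 0 := by
  simp [posRe]

lemma norm_posRe_le (z : 𝕜) : ‖posRe z‖ ≤ ‖z‖ := by
  rw [posRe, RCLike.norm_ofReal, abs_of_nonneg (le_max_right _ _)]
  exact max_le (RCLike.re_le_norm z) (norm_nonneg z)

lemma lipschitzWith_posRe : LipschitzWith 1 (posRe : 𝕜 → 𝕜) := by
  refine LipschitzWith.of_dist_le_mul fun z w => ?_
  rw [posRe, posRe, dist_eq_norm, dist_eq_norm, ← RCLike.ofReal_sub, RCLike.norm_ofReal,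
    NNReal.coe_one, one_mul]
  refine (abs_max_sub_max_le_abs _ _ _).trans ?_
  rw [← map_sub]
  exact RCLike.abs_re_le_norm _

lemma posRe_eq_self {z : 𝕜} (hz : 0 ≤ z) : posRe z = z := by
  obtain ⟨r, hr, rfl⟩ := RCLike.nonneg_iff_exists_ofReal.1 hz
  simp [posRe, hr]

/-- Reduces linear statements to non-negative values over both fields at once; in the real case
`RCLike.I = 0` and the second term disappears. -/
lemma eq_posRe_decomposition (z : 𝕜) :
    z = posRe z - posRe (-z) + RCLike.I * (posRe (-RCLike.I * z) - posRe (RCLike.I * z)) := by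
  have h : ∀ r : ℝ, max r 0 - max (-r) 0 = r := fun r => by
    rcases le_total 0 r with hr | hr
    · simp [hr]
    · simp [hr]
  have h1 : posRe z - posRe (-z) = ((RCLike.re z : ℝ) : 𝕜) := by
    rw [posRe, posRe, ← RCLike.ofReal_sub, map_neg, h]
  have h2 : posRe (-RCLike.I * z) - posRe (RCLike.I * z) = ((RCLike.im z : ℝ) : 𝕜) := by
    have h3 : RCLike.re (RCLike.I * z) = - RCLike.im z := by simp
    have h4 : RCLike.re (-RCLike.I * z) = RCLike.im z := by rw [neg_mul, map_neg, h3, neg_neg]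
    rw [posRe, posRe, ← RCLike.ofReal_sub, h4, h3, h]
  rw [h1, h2, mul_comm]
  exact (RCLike.re_add_im z).symm

/-- Gluing for scalar-valued functions. -/
lemma IsLocalizable.exists_glue_scalar (hμ : IsLocalizable μ) {ι : Type*} {A : ι → Set Ω}
    (hA : ∀ i, MeasurableSet (A i)) {h : ι → Ω → 𝕜} (hh : ∀ i, Measurable (h i))
    (hcomp : ∀ i j, ∀ᵐ x ∂μ, x ∈ A i → x ∈ A j → h i x = h j x) :
    ∃ H : Ω → 𝕜, Measurable H ∧ ∀ i, ∀ᵐ x ∂μ, x ∈ A i → H x = h i x := by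
  have hpos : ∀ c : 𝕜, ∃ H : Ω → 𝕜, Measurable H ∧
      ∀ i, ∀ᵐ x ∂μ, x ∈ A i → H x = posRe (c * h i x) := by
    intro c
    obtain ⟨H, hHm, hH⟩ := hμ.exists_glue hA
      (h := fun i x => ENNReal.ofReal (RCLike.re (c * h i x)))
      (fun i => (RCLike.measurable_re.comp ((hh i).const_mul c)).ennreal_ofReal)
      (fun i j => (hcomp i j).mono fun x hx hi hj => by simp only [hx hi hj])
    refine ⟨fun x => ((H x).toReal : 𝕜), RCLike.measurable_ofReal.comp hHm.ennreal_toReal,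
      fun i => (hH i).mono fun x hx hxi => ?_⟩
    simp only [hx hxi, posRe, ENNReal.toReal_ofReal']
  obtain ⟨H₁, hm₁, h₁⟩ := hpos 1
  obtain ⟨H₂, hm₂, h₂⟩ := hpos (-1)
  obtain ⟨H₃, hm₃, h₃⟩ := hpos (-RCLike.I)
  obtain ⟨H₄, hm₄, h₄⟩ := hpos RCLike.I
  refine ⟨fun x => H₁ x - H₂ x + RCLike.I * (H₃ x - H₄ x), by fun_prop, fun i => ?_⟩
  filter_upwards [h₁ i, h₂ i, h₃ i, h₄ i] with x g₁ g₂ g₃ g₄ hx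
  rw [g₁ hx, g₂ hx, g₃ hx, g₄ hx, one_mul, neg_one_mul]
  exact (eq_posRe_decomposition _).symm

omit [Fact (1 ≤ p)] in
/-- The multiplier of an operator on `L^p` of a localizable measure is unique. -/
lemma IsLocalizable.multiplier_unique (hμ : IsLocalizable μ) {h h' : Lp 𝕜 ∞ μ}
    (heq : ∀ ξ : Lp 𝕜 p μ, ∀ᵐ x ∂μ, h x * ξ x = h' x * ξ x) : h = h' := by
  refine Lp.ext ?_
  have hm : MeasurableSet {x | h x ≠ h' x} :=
    (measurableSet_eq_fun (Lp.stronglyMeasurable h).measurable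
      (Lp.stronglyMeasurable h').measurable).compl
  refine ae_iff.2 (hμ.measure_eq_zero hm fun A hA hAfin => ?_)
  rw [Set.inter_comm]
  have h1 : ∀ᵐ x ∂μ, ¬ (x ∈ A ∧ h x ≠ h' x) := by
    filter_upwards [heq (indicatorConstLp p hA hAfin.ne 1),
      indicatorConstLp_coeFn_mem (p := p) (hs := hA) (hμs := hAfin.ne) (c := (1 : 𝕜))]
      with x h2 h3 h4
    rw [h3 h4.1, mul_one, mul_one] at h2
    exact h4.2 h2
  exact measure_eq_zero_iff_ae_notMem.2 h1

/-- A pointwise dominated operator on `L^p` of a localizable measure is a multiplication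
operator. -/
lemma IsLocalizable.exists_multiplier (hμ : IsLocalizable μ) {T : Lp 𝕜 p μ →L[𝕜] Lp 𝕜 p μ}
    {C : ℝ} (hC : 0 ≤ C) (hT : ∀ ξ : Lp 𝕜 p μ, ∀ᵐ x ∂μ, ‖T ξ x‖ ≤ C * ‖ξ x‖) :
    ∃ h : Lp 𝕜 ∞ μ, ‖h‖ ≤ C ∧ ∀ ξ : Lp 𝕜 p μ, ∀ᵐ x ∂μ, T ξ x = h x * ξ x := by
  let ι := {A : Set Ω // MeasurableSet A ∧ μ A ≠ ∞}
  let η : ι → Lp 𝕜 p μ := fun A => indicatorConstLp p A.2.1 A.2.2 1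
  have hη : ∀ A : ι, ∀ᵐ x ∂μ, x ∈ A.1 → η A x = 1 := fun A => indicatorConstLp_coeFn_mem
  -- On `A` the multiplier must be `T 1_A`. The symmetry `T 1_A * 1_B = 1_A * T 1_B` is exactly the
  -- compatibility on overlaps.
  obtain ⟨H, hHm, hH⟩ := hμ.exists_glue_scalar (A := fun A : ι => A.1) (fun A => A.2.1)
    (h := fun A => T (η A)) (fun A => (Lp.stronglyMeasurable _).measurable) (fun A B => by
      filter_upwards [hη A, hη B, ae_mul_eq_mul_of_ae_norm_le hT (η A) (η B)] with x h1 h2 h3 hA hB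
      simpa [h1 hA, h2 hB] using h3)
  have hmul : ∀ ξ : Lp 𝕜 p μ, ∀ᵐ x ∂μ, T ξ x = H x * ξ x := by
    intro ξ
    have hm : MeasurableSet {x | T ξ x ≠ H x * ξ x} :=
      (measurableSet_eq_fun (Lp.stronglyMeasurable (T ξ)).measurable
        (hHm.mul (Lp.stronglyMeasurable ξ).measurable)).compl
    refine ae_iff.2 (hμ.measure_eq_zero hm fun A hA hAfin => ?_)
    have h1 : ∀ᵐ x ∂μ, ¬ (T ξ x ≠ H x * ξ x ∧ x ∈ A) := by
      filter_upwards [hη ⟨A, hA, hAfin.ne⟩, hH ⟨A, hA, hAfin.ne⟩,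
        ae_mul_eq_mul_of_ae_norm_le hT ξ (η ⟨A, hA, hAfin.ne⟩)] with x h2 h3 h4 h5
      rw [h2 h5.2, mul_one, ← h3 h5.2, mul_comm] at h4
      exact h5.1 h4
    exact measure_eq_zero_iff_ae_notMem.2 h1
  have hbound : ∀ᵐ x ∂μ, ‖H x‖ ≤ C := by
    have hm : MeasurableSet {x | ¬ ‖H x‖ ≤ C} := (hHm.norm measurableSet_Iic).compl
    refine ae_iff.2 (hμ.measure_eq_zero hm fun A hA hAfin => ?_)
    have h1 : ∀ᵐ x ∂μ, ¬ (¬ ‖H x‖ ≤ C ∧ x ∈ A) := by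
      filter_upwards [hη ⟨A, hA, hAfin.ne⟩, hH ⟨A, hA, hAfin.ne⟩, hT (η ⟨A, hA, hAfin.ne⟩)]
        with x h2 h3 h4 h5
      rw [h2 h5.2, norm_one, mul_one, ← h3 h5.2] at h4
      exact h5.1 h4
    exact measure_eq_zero_iff_ae_notMem.2 h1
  have hmem : MemLp H ∞ μ := memLp_top_of_bound hHm.aestronglyMeasurable C hbound
  refine ⟨hmem.toLp, ?_, fun ξ => ?_⟩
  · rw [Lp.norm_toLp]
    refine ENNReal.toReal_le_of_le_ofReal hC ?_
    rw [eLpNorm_exponent_top]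
    exact eLpNormEssSup_le_of_ae_bound hbound
  · filter_upwards [hmul ξ, hmem.coeFn_toLp] with x h1 h2
    rw [h1, h2]

omit [Fact (1 ≤ p)] in
-- Presents the positive cone as the fixed points of a continuous map, which makes it closed.
lemma Lp.ae_nonneg_iff_compLp_posRe {ξ : Lp 𝕜 p μ} :
    (∀ᵐ x ∂μ, 0 ≤ ξ x) ↔ lipschitzWith_posRe.compLp posRe_zero ξ = ξ := by
  constructor
  · intro h
    refine Lp.ext ?_
    filter_upwards [h, lipschitzWith_posRe.coeFn_compLp posRe_zero ξ] with x h1 h2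
    rw [h2, Function.comp_apply, posRe_eq_self h1]
  · intro h
    have h2 := lipschitzWith_posRe.coeFn_compLp posRe_zero ξ
    rw [h] at h2
    filter_upwards [h2] with x hx
    rw [hx]
    exact posRe_nonneg _

lemma Lp.isClosed_setOf_ae_nonneg : IsClosed {ξ : Lp 𝕜 p μ | ∀ᵐ x ∂μ, 0 ≤ ξ x} := by
  simp only [Lp.ae_nonneg_iff_compLp_posRe]
  exact isClosed_eq (lipschitzWith_posRe.continuous_compLp posRe_zero) continuous_id

end MultiplicationOperators

/-! ### Hermitian operators on `L^p` are local -/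

section Hermitian

/-- An operator `T` is Hermitian if `‖1 + itT‖ ≤ 1 + O(t²)` for real `t`. -/
def IsHermitianOp {E : Type*} [NormedAddCommGroup E] [NormedSpace ℂ E] (T : E →L[ℂ] E)
    (C : ℝ) : Prop :=
  ∀ (t : ℝ) (ξ : E), ‖ξ + ((t : ℂ) * Complex.I) • T ξ‖ ≤ (1 + t ^ 2 * C) * ‖ξ‖

/-- The term of first order in `t` is `-t * z.im`, and a bound `O(t²)` for both signs of `t` forces
it to vanish. Rational `t` suffice, so the hypothesis can be checked almost everywhere. -/
lemma im_eq_zero_of_forall_norm_le {z : ℂ} {C : ℝ}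
    (h : ∀ t : ℚ, ‖1 + ((t : ℝ) : ℂ) * Complex.I * z‖ ≤ 1 + (t : ℝ) ^ 2 * C) : z.im = 0 := by
  have hre : ∀ t : ℚ, -(t * z.im) ≤ (t : ℝ) ^ 2 * C := fun t => by
    have h1 := (Complex.re_le_norm _).trans (h t)
    simp at h1
    linarith
  have hle : ∀ t : ℚ, 0 < t → |z.im| ≤ t * C := fun t ht => by
    have ht' : (0 : ℝ) < t := by exact_mod_cast ht
    have h1 := hre t
    have h2 := hre (-t)
    push_cast at h2
    rw [abs_le]
    constructor <;> nlinarith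
  by_contra hne
  have hpos : 0 < |z.im| := abs_pos.2 hne
  obtain ⟨t, ht0, ht1⟩ := exists_rat_btwn (show 0 < |z.im| / (|C| + 1) by positivity)
  have h1 := hle t (by exact_mod_cast ht0)
  rw [lt_div_iff₀ (by positivity)] at ht1
  nlinarith [le_abs_self C, mul_le_mul_of_nonneg_left (le_abs_self C) ht0.le]

/-- The duality map of `L^q`: `lpDual q z = conj z * |z|^(q-2)`. -/
noncomputable def lpDual (q : ℝ) (z : ℂ) : ℂ := (starRingEnd ℂ) z * ((‖z‖ ^ (q - 2) : ℝ) : ℂ)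

@[simp] lemma lpDual_zero (q : ℝ) : lpDual q 0 = 0 := by simp [lpDual]

lemma lpDual_mul (q : ℝ) (z w : ℂ) : lpDual q (z * w) = lpDual q z * lpDual q w := by
  simp only [lpDual, map_mul, norm_mul, Real.mul_rpow (norm_nonneg z) (norm_nonneg w)]
  push_cast
  ring

lemma mul_lpDual_self {q : ℝ} (hq : 1 ≤ q) (z : ℂ) :
    z * lpDual q z = ((‖z‖ ^ q : ℝ) : ℂ) := by
  rcases eq_or_ne z 0 with rfl | hz
  · simp [Real.zero_rpow (by linarith : q ≠ 0)]
  · have h : ‖z‖ ^ q = ‖z‖ ^ 2 * ‖z‖ ^ (q - 2) := by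
      rw [← Real.rpow_natCast, ← Real.rpow_add (norm_pos_iff.2 hz)]
      congr 1
      push_cast
      ring
    rw [lpDual, ← mul_assoc, Complex.mul_conj, h, Complex.normSq_eq_norm_sq]
    push_cast
    ring

lemma norm_lpDual_le {q : ℝ} (z : ℂ) : ‖lpDual q z‖ ≤ ‖z‖ ^ (q - 1) := by
  rcases eq_or_ne z 0 with rfl | hz
  · simp
    positivity
  · have h : ‖z‖ ^ (q - 1) = ‖z‖ * ‖z‖ ^ (q - 2) := by
      rw [mul_comm, ← Real.rpow_add_one (norm_ne_zero_iff.2 hz)]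
      congr 1
      ring
    rw [lpDual, h, norm_mul, Complex.norm_conj, Complex.norm_real, Real.norm_of_nonneg]
    positivity

lemma measurable_lpDual (q : ℝ) : Measurable (lpDual q) := by
  unfold lpDual
  fun_prop

/-- The function `|·|^q` lies above its tangents. -/
lemma norm_rpow_add_le {q : ℝ} (hq : 1 ≤ q) (z w : ℂ) :
    ‖z‖ ^ q + q * (w * lpDual q z).re ≤ ‖z + w‖ ^ q := by
  rcases eq_or_ne z 0 with rfl | hz
  · simp [Real.zero_rpow (by linarith : q ≠ 0)]
    positivity
  · have hy : 0 < ‖z‖ := norm_pos_iff.2 hz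
    have h1 : (w * lpDual q z).re ≤ ‖z‖ ^ (q - 1) * (‖z + w‖ - ‖z‖) := by
      have h2 : (w * lpDual q z).re = ((z + w) * lpDual q z).re - ‖z‖ ^ q := by
        rw [add_mul, mul_lpDual_self hq, Complex.add_re, Complex.ofReal_re]
        ring
      have h3 : ‖z‖ ^ q = ‖z‖ ^ (q - 1) * ‖z‖ := by
        rw [← Real.rpow_add_one hy.ne']
        congr 1
        ring
      have h4 : ((z + w) * lpDual q z).re ≤ ‖z + w‖ * ‖z‖ ^ (q - 1) :=
        (Complex.re_le_norm _).trans (by rw [norm_mul]; gcongr; exact norm_lpDual_le z)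
      rw [h2, h3]
      linarith
    have h5 : ‖z‖ ^ q + q * (‖z‖ ^ (q - 1) * (‖z + w‖ - ‖z‖)) ≤ ‖z + w‖ ^ q := by
      -- Bernoulli's inequality with `1 + s = ‖z + w‖ / ‖z‖`.
      have h6 := one_add_mul_self_le_rpow_one_add (s := ‖z + w‖ / ‖z‖ - 1)
        (by have : 0 ≤ ‖z + w‖ / ‖z‖ := by positivity
            linarith) hq
      rw [add_sub_cancel, Real.div_rpow (norm_nonneg _) hy.le, le_div_iff₀ (by positivity)] at h6
      refine le_trans (le_of_eq ?_) h6
      rw [Real.rpow_sub_one hy.ne']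
      field_simp
    nlinarith

/-- Gives integrability of the duality pairing without Hölder's inequality. -/
lemma norm_mul_lpDual_le {q : ℝ} (hq : 1 ≤ q) (z w : ℂ) :
    ‖w * lpDual q z‖ ≤ ‖w‖ ^ q + ‖z‖ ^ q := by
  have hm0 : 0 ≤ max ‖w‖ ‖z‖ := le_max_of_le_left (norm_nonneg w)
  calc ‖w * lpDual q z‖ ≤ ‖w‖ * ‖z‖ ^ (q - 1) := by
        rw [norm_mul]; gcongr; exact norm_lpDual_le z
    _ ≤ max ‖w‖ ‖z‖ * max ‖w‖ ‖z‖ ^ (q - 1) := by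
        exact mul_le_mul (le_max_left _ _) (Real.rpow_le_rpow (norm_nonneg z) (le_max_right _ _)
          (by linarith)) (by positivity) hm0
    _ = max ‖w‖ ‖z‖ ^ q := by
        rw [← Real.rpow_one_add' hm0 (by linarith)]
        congr 1
        ring
    _ ≤ ‖w‖ ^ q + ‖z‖ ^ q := by
        have h1 : 0 ≤ ‖w‖ ^ q := by positivity
        have h2 : 0 ≤ ‖z‖ ^ q := by positivity
        rcases max_choice ‖w‖ ‖z‖ with h | h <;> rw [h] <;> linarith

variable {Ω : Type*} [MeasurableSpace Ω] {μ : Measure Ω} {p : ℝ≥0∞} [Fact (1 ≤ p)]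

omit [Fact (1 ≤ p)] in
lemma integrable_norm_rpow_toReal (hp1 : 1 ≤ p) (hpt : p ≠ ∞) (f : Lp ℂ p μ) :
    Integrable (fun x => ‖f x‖ ^ p.toReal) μ :=
  (Lp.memLp f).integrable_norm_rpow (one_pos.trans_le hp1).ne' hpt

omit [Fact (1 ≤ p)] in
lemma Lp.norm_rpow_toReal_eq_integral (hp1 : 1 ≤ p) (hpt : p ≠ ∞) (f : Lp ℂ p μ) :
    ‖f‖ ^ p.toReal = ∫ x, ‖f x‖ ^ p.toReal ∂μ := by
  have hp0 : p ≠ 0 := (one_pos.trans_le hp1).ne'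
  have hInt : 0 ≤ ∫ x, ‖f x‖ ^ p.toReal ∂μ := integral_nonneg fun x => by positivity
  rw [Lp.norm_def, (Lp.memLp f).eLpNorm_eq_integral_rpow_norm hp0 hpt,
    ENNReal.toReal_ofReal (by positivity), ← Real.rpow_mul hInt,
    inv_mul_cancel₀ (ENNReal.toReal_pos hp0 hpt).ne', Real.rpow_one]

omit [Fact (1 ≤ p)] in
lemma integrable_mul_lpDual (hp1 : 1 ≤ p) (hpt : p ≠ ∞) (g f : Lp ℂ p μ) :
    Integrable (fun x => g x * lpDual p.toReal (f x)) μ := by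
  refine ((integrable_norm_rpow_toReal hp1 hpt g).add
    (integrable_norm_rpow_toReal hp1 hpt f)).mono' ?_ (Eventually.of_forall fun x => ?_)
  · exact ((Lp.stronglyMeasurable g).measurable.mul ((measurable_lpDual _).comp
      (Lp.stronglyMeasurable f).measurable)).aestronglyMeasurable
  · exact norm_mul_lpDual_le (by simpa using ENNReal.toReal_mono hpt hp1) _ _

/-- First-order optimality for the norm of `L^p`. -/
lemma re_integral_mul_lpDual_eq_zero (hpt : p ≠ ∞) {f g : Lp ℂ p μ} {C : ℝ} (hC : 0 ≤ C)
    (h : ∀ t : ℝ, ‖f + (t : ℂ) • g‖ ≤ (1 + t ^ 2 * C) * ‖f‖) :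
    (∫ x, g x * lpDual p.toReal (f x) ∂μ).re = 0 := by
  have hp1 : 1 ≤ p := Fact.out
  set q := p.toReal with hqdef
  have hq : 1 ≤ q := by simpa using ENNReal.toReal_mono hpt hp1
  set R := (∫ x, g x * lpDual q (f x) ∂μ).re with hR
  have hInt := integrable_mul_lpDual hp1 hpt g f
  -- Integrating the tangent inequality bounds `‖f + t g‖ ^ q` from below, so no differentiation
  -- under the integral is needed. The gap `D` below is non-negative, vanishes at `0` and has
  -- derivative `-q R` there.
  have hkey : ∀ t : ℝ, ‖f‖ ^ q + q * (t * R) ≤ (1 + t ^ 2 * C) ^ q * ‖f‖ ^ q := by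
    intro t
    rw [← Real.mul_rpow (by positivity) (norm_nonneg f)]
    refine le_trans ?_ (Real.rpow_le_rpow (norm_nonneg _) (h t) (by linarith))
    have hRint : R = ∫ x, (g x * lpDual q (f x)).re ∂μ := by
      rw [hR]
      exact (integral_re hInt).symm
    have hre : Integrable (fun x => (g x * lpDual q (f x)).re) μ := hInt.re
    rw [hqdef, Lp.norm_rpow_toReal_eq_integral hp1 hpt,
      Lp.norm_rpow_toReal_eq_integral hp1 hpt, ← hqdef, hRint, ← integral_const_mul,
      ← integral_const_mul, ← integral_add (integrable_norm_rpow_toReal hp1 hpt f)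
        ((hre.const_mul t).const_mul q)]
    refine integral_mono_ae ((integrable_norm_rpow_toReal hp1 hpt f).add
      ((hre.const_mul t).const_mul q)) (integrable_norm_rpow_toReal hp1 hpt _) ?_
    filter_upwards [Lp.coeFn_add f ((t : ℂ) • g), Lp.coeFn_smul (t : ℂ) g] with x h1 h2
    rw [h1, Pi.add_apply, h2, Pi.smul_apply, smul_eq_mul]
    have h3 := norm_rpow_add_le hq (f x) ((t : ℂ) * g x)
    rwa [mul_assoc, Complex.re_ofReal_mul] at h3
  set D : ℝ → ℝ := fun t => (1 + t ^ 2 * C) ^ q * ‖f‖ ^ q - (‖f‖ ^ q + q * (t * R)) with hD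
  have hmin : IsLocalMin D 0 := by
    refine Eventually.of_forall fun t => ?_
    have h0 : D 0 = 0 := by simp [hD]
    rw [h0]
    exact sub_nonneg.2 (hkey t)
  have hder : HasDerivAt D (-(q * R)) 0 := by
    have h1 : HasDerivAt (fun t : ℝ => 1 + t ^ 2 * C) 0 0 := by
      simpa using (((hasDerivAt_id (0 : ℝ)).pow 2).mul_const C).const_add 1
    have h2 := (h1.rpow_const (p := q) (Or.inr hq)).mul_const (‖f‖ ^ q)
    have h3 : HasDerivAt (fun t : ℝ => ‖f‖ ^ q + q * (t * R)) (q * R) 0 := by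
      simpa using (((hasDerivAt_id (0 : ℝ)).mul_const R).const_mul q).const_add (‖f‖ ^ q)
    have h4 := h2.sub h3
    simp only [zero_mul, zero_sub] at h4
    exact h4
  have := hmin.hasDerivAt_eq_zero hder
  have hq0 : q ≠ 0 := by linarith
  simpa [hq0] using this

/-- Hermitian operators on `L^p` with `p < ∞`, `p ≠ 2`, are local. -/
lemma IsHermitianOp.isLocalOnLp_of_ne_top (hp : p ≠ 2) (hpt : p ≠ ∞)
    {T : Lp ℂ p μ →L[ℂ] Lp ℂ p μ} {C : ℝ} (hC : 0 ≤ C) (hT : IsHermitianOp T C) :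
    IsLocalOnLp T := by
  have hp1 : 1 ≤ p := Fact.out
  set q := p.toReal with hqdef
  have hq : 1 ≤ q := by simpa using ENNReal.toReal_mono hpt hp1
  have hq2 : q ≠ 2 := fun h => hp (by
    rw [← ENNReal.ofReal_toReal hpt, ← hqdef, h]; simp)
  set B : Lp ℂ p μ → Lp ℂ p μ → ℂ := fun g f => ∫ x, g x * lpDual q (f x) ∂μ with hB
  have hInt : ∀ g f : Lp ℂ p μ, Integrable (fun x => g x * lpDual q (f x)) μ :=
    integrable_mul_lpDual hp1 hpt
  have him : ∀ f, (B (T f) f).im = 0 := by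
    intro f
    have h := re_integral_mul_lpDual_eq_zero hpt (f := f) (g := Complex.I • T f) hC
      (fun t => by simpa [smul_smul] using hT t f)
    have h2 : ∫ x, (Complex.I • T f : Lp ℂ p μ) x * lpDual p.toReal (f x) ∂μ =
        Complex.I * B (T f) f := by
      rw [hB, ← integral_const_mul]
      refine integral_congr_ae ?_
      filter_upwards [Lp.coeFn_smul Complex.I (T f)] with x hx
      rw [hx, Pi.smul_apply, smul_eq_mul, mul_assoc]
    rw [h2] at h
    simpa using h
  intro v
  have hAm : MeasurableSet {x | v x = 0} :=
    (Lp.stronglyMeasurable v).measurable (measurableSet_singleton 0)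
  -- The part `u` of `T v` that violates locality is disjoint from `v`, and `B (T v) u = ‖u‖ ^ q`;
  -- it remains to show that this pairing is zero.
  have hu : MemLp ({x | v x = 0}.indicator (T v)) p μ := (Lp.memLp (T v)).indicator hAm
  set u : Lp ℂ p μ := hu.toLp with hudef
  have hux : ∀ᵐ x ∂μ, u x = {x | v x = 0}.indicator (T v) x := hu.coeFn_toLp
  have hexp : ∀ c : ℂ, B (T (u + c • v)) (u + c • v) = B (T u) u + lpDual q c * B (T u) v +
      c * B (T v) u + ((‖c‖ ^ q : ℝ) : ℂ) * B (T v) v := by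
    intro c
    simp only [hB]
    have i₁ := (hInt (T u) v).const_mul (lpDual q c)
    have i₂ := (hInt (T v) u).const_mul c
    have i₃ := (hInt (T v) v).const_mul (c * lpDual q c)
    have i₄ : Integrable (fun x => T u x * lpDual q (u x) +
      lpDual q c * (T u x * lpDual q (v x))) μ := (hInt _ _).add i₁
    have i₅ : Integrable (fun x => T u x * lpDual q (u x) +
      lpDual q c * (T u x * lpDual q (v x)) + c * (T v x * lpDual q (u x))) μ := i₄.add i₂
    rw [← mul_lpDual_self hq c, ← integral_const_mul, ← integral_const_mul, ← integral_const_mul,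
      ← integral_add (hInt _ _) i₁, ← integral_add i₄ i₂, ← integral_add i₅ i₃]
    refine integral_congr_ae ?_
    rw [map_add, map_smul]
    filter_upwards [hux, Lp.coeFn_add u (c • v), Lp.coeFn_smul c v,
      Lp.coeFn_add (T u) (c • T v), Lp.coeFn_smul c (T v)] with x h1 h2 h3 h4 h5
    rw [h2, h4, Pi.add_apply, Pi.add_apply, h3, h5, Pi.smul_apply, Pi.smul_apply, smul_eq_mul,
      smul_eq_mul]
    have h6 : lpDual q (u x + c * v x) = lpDual q (u x) + lpDual q c * lpDual q (v x) := by
      by_cases hx : v x = 0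
      · simp [hx]
      · have : u x = 0 := h1.trans (Set.indicator_of_notMem (s := {x | v x = 0}) hx _)
        rw [this, zero_add, lpDual_zero, zero_add, lpDual_mul]
    rw [h6]
    ring
  have hc : ∀ c : ℂ, (lpDual q c * B (T u) v + c * B (T v) u).im = 0 := by
    intro c
    have h := him (u + c • v)
    rw [hexp c] at h
    simp only [Complex.add_im, Complex.im_ofReal_mul, him, mul_zero, add_zero, zero_add] at h
    simpa using h
  have hpow : (2 : ℝ) * 2 ^ (q - 2) ≠ 2 := by
    intro h
    have h1 : (2 : ℝ) ^ (q - 2) = 1 := by linarith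
    have h2 := congrArg Real.log h1
    rw [Real.log_rpow two_pos, Real.log_one, mul_eq_zero] at h2
    rcases h2 with h2 | h2
    · exact hq2 (by linarith)
    · exact (Real.log_pos one_lt_two).ne' h2
  -- The scalars `1` and `2` give two equations for the imaginary parts of `B (T u) v` and `B (T v)
  -- u`, and `I` and `2I` give two for the real parts. Both systems are non-singular because `2 ^ (q
  -- - 1) ≠ 2`.
  have hP : B (T v) u = 0 := by
    have e1 : lpDual q 1 = 1 := by simp [lpDual]
    have e2 : lpDual q 2 = ((2 * 2 ^ (q - 2) : ℝ) : ℂ) := by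
      simpa [lpDual] using Or.inl (map_ofNat (starRingEnd ℂ) 2)
    have eI : lpDual q Complex.I = -Complex.I := by simp [lpDual]
    have h1 := hc 1
    have h2 := hc ((2 : ℝ) : ℂ)
    have h3 := hc Complex.I
    have h4 := hc (((2 : ℝ) : ℂ) * Complex.I)
    rw [lpDual_mul] at h4
    rw [Complex.ofReal_ofNat, e2, ← Complex.ofReal_ofNat] at h2 h4
    rw [e1] at h1
    rw [eI] at h3 h4
    rw [mul_assoc, mul_assoc] at h4
    simp only [Complex.add_im, Complex.im_ofReal_mul, Complex.neg_im, one_mul, neg_mul,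
      Complex.I_mul_im] at h1 h2 h3 h4
    generalize (2 : ℝ) * 2 ^ (q - 2) = s at hpow h2 h4
    apply Complex.ext
    · have h5 : (s - 2) * (B (T v) u).re = 0 := by linear_combination (-1) * h4 + s * h3
      simpa using (mul_eq_zero.1 h5).resolve_left (sub_ne_zero.2 hpow)
    · have h5 : (s - 2) * (B (T v) u).im = 0 := by linear_combination (-1) * h2 + s * h1
      simpa using (mul_eq_zero.1 h5).resolve_left (sub_ne_zero.2 hpow)
  have hPu : B (T v) u = ((‖u‖ ^ q : ℝ) : ℂ) := by
    rw [hqdef, Lp.norm_rpow_toReal_eq_integral hp1 hpt, ← integral_complex_ofReal]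
    refine integral_congr_ae ?_
    filter_upwards [hux] with x hx
    by_cases hxv : v x = 0
    · have hxu : u x = T v x := hx.trans (Set.indicator_of_mem (s := {x | v x = 0}) hxv _)
      rw [hxu, mul_lpDual_self hq]
    · have hxu : u x = 0 := hx.trans (Set.indicator_of_notMem (s := {x | v x = 0}) hxv _)
      rw [hxu, lpDual_zero, mul_zero, norm_zero, Real.zero_rpow (by linarith : p.toReal ≠ 0),
        Complex.ofReal_zero]
  have hu0 : u = 0 := by
    rw [hP, eq_comm, Complex.ofReal_eq_zero, Real.rpow_eq_zero (norm_nonneg u) (by linarith)] at hPu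
    exact norm_eq_zero.1 hPu
  filter_upwards [hux, Lp.eq_zero_iff_ae_eq_zero.1 hu0] with x h1 h2 hxv
  have hxu : u x = T v x := h1.trans (Set.indicator_of_mem (s := {x | v x = 0}) hxv _)
  rw [← hxu, h2, Pi.zero_apply]

lemma Lp.ae_norm_le_norm_of_top (f : Lp ℂ ∞ μ) : ∀ᵐ x ∂μ, ‖f x‖ ≤ ‖f‖ := by
  have h := ae_le_eLpNormEssSup (f := f) (μ := μ)
  filter_upwards [h] with x hx
  rw [← eLpNorm_exponent_top] at hx
  rw [Lp.norm_def]
  simpa using ENNReal.toReal_mono (Lp.eLpNorm_ne_top f) hx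

/-- Where `F` equals `1`, its maximal modulus, the Hermitian bound reads `|1 + it T F x| ≤ 1 + C
t²`. -/
lemma IsHermitianOp.ae_im_eq_zero {T : Lp ℂ ∞ μ →L[ℂ] Lp ℂ ∞ μ} {C : ℝ}
    (hC : 0 ≤ C) (hT : IsHermitianOp T C) {F : Lp ℂ ∞ μ} (hF : ∀ᵐ x ∂μ, ‖F x‖ ≤ 1) :
    ∀ᵐ x ∂μ, F x = 1 → (T F x).im = 0 := by
  have hF1 : ‖F‖ ≤ 1 := by
    rw [Lp.norm_def, eLpNorm_exponent_top]
    refine ENNReal.toReal_le_of_le_ofReal zero_le_one (eLpNormEssSup_le_of_ae_bound hF)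
  have hall : ∀ᵐ x ∂μ, ∀ t : ℚ,
      ‖F x + ((t : ℝ) : ℂ) * Complex.I * T F x‖ ≤ 1 + (t : ℝ) ^ 2 * C := by
    rw [ae_all_iff]
    intro t
    have h1 : ‖F + (((t : ℝ) : ℂ) * Complex.I) • T F‖ ≤ 1 + (t : ℝ) ^ 2 * C :=
      (hT t F).trans (mul_le_of_le_one_right (by positivity) hF1)
    filter_upwards [Lp.ae_norm_le_norm_of_top (F + (((t : ℝ) : ℂ) * Complex.I) • T F),
      Lp.coeFn_add F ((((t : ℝ) : ℂ) * Complex.I) • T F),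
      Lp.coeFn_smul (((t : ℝ) : ℂ) * Complex.I) (T F)] with x h2 h3 h4
    rw [h3, Pi.add_apply, h4] at h2
    exact h2.trans h1
  filter_upwards [hall] with x hx h1
  rw [h1] at hx
  exact im_eq_zero_of_forall_norm_le hx

/-- Hermitian operators on `L^∞` are local. -/
lemma IsHermitianOp.isLocalOnLp_top {T : Lp ℂ ∞ μ →L[ℂ] Lp ℂ ∞ μ} {C : ℝ}
    (hC : 0 ≤ C) (hT : IsHermitianOp T C) : IsLocalOnLp T := by
  intro ξ
  have hAm : MeasurableSet {x | ξ x = 0} :=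
    (Lp.stronglyMeasurable ξ).measurable (measurableSet_singleton 0)
  have hχ : MemLp ({x | ξ x = 0}.indicator fun _ => (1 : ℂ)) ∞ μ :=
    (memLp_top_const (1 : ℂ)).indicator hAm
  -- For small `c` the function `1_{ξ = 0} + c ξ` stays in the unit ball and equals `1` where `ξ`
  -- vanishes. Varying `c` over `0`, `s` and `sI` isolates `T ξ`.
  have key : ∀ c : ℂ, ‖c‖ * ‖ξ‖ ≤ 1 →
      ∀ᵐ x ∂μ, ξ x = 0 → (T hχ.toLp x).im + (c * T ξ x).im = 0 := by
    intro c hc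
    have hF : ∀ᵐ x ∂μ, ‖(hχ.toLp + c • ξ : Lp ℂ ∞ μ) x‖ ≤ 1 := by
      filter_upwards [Lp.coeFn_add hχ.toLp (c • ξ), Lp.coeFn_smul c ξ, hχ.coeFn_toLp,
        Lp.ae_norm_le_norm_of_top ξ] with x h1 h2 h3 h4
      rw [h1, Pi.add_apply, h2, h3, Pi.smul_apply, smul_eq_mul]
      by_cases hx : ξ x = 0
      · simp [Set.indicator, hx]
      · simp only [Set.indicator, Set.mem_ofPred_eq, hx, if_false, zero_add, norm_mul]
        exact le_trans (by gcongr) hc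
    have him := hT.ae_im_eq_zero hC hF
    rw [map_add, map_smul] at him
    filter_upwards [him, Lp.coeFn_add hχ.toLp (c • ξ), Lp.coeFn_smul c ξ, hχ.coeFn_toLp,
      Lp.coeFn_add (T hχ.toLp) (c • T ξ), Lp.coeFn_smul c (T ξ)] with x h1 h2 h3 h4 h5 h6 hx
    rw [h2, Pi.add_apply, h3, h4, Pi.smul_apply, hx, h5, Pi.add_apply, h6, Pi.smul_apply,
      smul_eq_mul, smul_eq_mul, mul_zero, add_zero, Complex.add_im] at h1
    exact h1 (Set.indicator_of_mem (s := {x | ξ x = 0}) hx _)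
  set s : ℝ := (‖ξ‖ + 1)⁻¹ with hs
  have hs0 : 0 < s := by positivity
  have hs1 : s * ‖ξ‖ ≤ 1 := by
    rw [hs, inv_mul_le_iff₀ (by positivity)]
    linarith
  filter_upwards [key 0 (by simp), key (s : ℂ) (by simpa [abs_of_pos hs0] using hs1),
    key ((s : ℂ) * Complex.I) (by simpa [abs_of_pos hs0] using hs1)] with x h0 h1 h2 hx
  have h0 := h0 hx
  have h1 := h1 hx
  have h2 := h2 hx
  rw [zero_mul, Complex.zero_im, add_zero] at h0
  rw [mul_assoc] at h2
  rw [h0, zero_add, Complex.im_ofReal_mul] at h1 h2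
  apply Complex.ext
  · simpa [hs0.ne'] using h2
  · simpa [hs0.ne'] using h1

/-- Hermitian operators on `L^p` with `p ≠ 2` are local. -/
lemma IsHermitianOp.isLocalOnLp (hp : p ≠ 2) {T : Lp ℂ p μ →L[ℂ] Lp ℂ p μ} {C : ℝ}
    (hC : 0 ≤ C) (hT : IsHermitianOp T C) : IsLocalOnLp T := by
  by_cases hpt : p = ∞
  · subst hpt
    exact hT.isLocalOnLp_top hC
  · exact hT.isLocalOnLp_of_ne_top hp hpt hC

/-- For `w ≠ 0` the bounds put `z / w` in the discs with centre `M / 2 - is` whose boundary circles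
pass through `0` and `M`. Large `s` of both signs squeeze out the imaginary part, and `s = 0` then
gives the sign. -/
lemma nonneg_of_forall_norm_le {z w : ℂ} {M : ℝ} (hM : 0 ≤ M) (hw : 0 ≤ w)
    (h : ∀ s : ℤ, ‖z + (-(M / 2 : ℝ) + (s : ℝ) * Complex.I) * w‖ ≤
      √(M ^ 2 / 4 + s ^ 2) * ‖w‖) : 0 ≤ z := by
  obtain ⟨r, hr, rfl⟩ := RCLike.nonneg_iff_exists_ofReal.1 hw
  have hsq : ∀ s : ℤ, z.re ^ 2 - M * r * z.re + z.im ^ 2 + 2 * s * r * z.im ≤ 0 := by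
    intro s
    have h1 := pow_le_pow_left₀ (norm_nonneg _) (h s) 2
    rw [mul_pow, Real.sq_sqrt (by positivity), ← Complex.normSq_eq_norm_sq,
      Complex.normSq_apply] at h1
    simp at h1
    nlinarith
  rcases eq_or_lt_of_le hr with h0 | hpos
  · have h1 := hsq 0
    rw [← h0] at h1
    have h2 : z.re = 0 := by nlinarith [sq_nonneg z.re, sq_nonneg z.im]
    have h3 : z.im = 0 := by nlinarith [sq_nonneg z.re, sq_nonneg z.im]
    rw [Complex.ext (z := z) (w := 0) h2 h3]
  · have him : z.im = 0 := by
      by_contra hne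
      obtain ⟨n, hn⟩ := exists_nat_gt (|z.re ^ 2 - M * r * z.re| / (2 * r * |z.im|))
      rw [div_lt_iff₀ (by positivity)] at hn
      have h1 := hsq n
      have h2 := hsq (-n)
      push_cast at h1 h2
      have h3 := neg_abs_le (z.re ^ 2 - M * r * z.re)
      have h4 := sq_nonneg z.im
      rcases abs_cases z.im with ⟨h5, _⟩ | ⟨h5, _⟩ <;> rw [h5] at hn <;> nlinarith
    have h1 := hsq 0
    rw [him] at h1
    rw [Complex.nonneg_iff]
    refine ⟨?_, him.symm⟩
    by_contra! hlt
    nlinarith [mul_nonneg hM hr, sq_pos_of_neg hlt]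

end Hermitian

/-! ### Locality on `C₀`, non-negative parts and order bounds -/

section ContinuousFunctions

variable {Y : Type*} [TopologicalSpace Y]

/-- Hermitian operators on `C₀(Y)` are local. -/
lemma IsHermitianOp.apply_eq_zero_of_apply_eq_zero [LocallyCompactSpace Y] [T2Space Y]
    {T : C₀(Y, ℂ) →L[ℂ] C₀(Y, ℂ)} {C : ℝ} (hC : 0 ≤ C) (hT : IsHermitianOp T C)
    {f : C₀(Y, ℂ)} {y : Y} (hf : f y = 0) : T f y = 0 := by
  set r : ℝ := (‖f‖ + 1)⁻¹ with hr
  have hr0 : 0 < r := by positivity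
  have hr1 : r * ‖f‖ ≤ 1 := by
    rw [hr, inv_mul_le_iff₀ (by positivity)]
    linarith
  -- A bump at `y`, supported where `f` is small, replaces the indicator. The norm of `g + c • f`
  -- exceeds `1` by at most `s²`, so `t = ±s` in the Hermitian bound leaves an error `O(s)` after
  -- division by `s`.
  have key : ∀ s : ℝ, 0 < s → s ≤ 1 → ∃ g : C₀(Y, ℂ), ∀ c : ℂ, ‖c‖ ≤ r →
      |(T g y).im + (c * T f y).im| ≤ (1 + 2 * C) * s := by
    intro s hs hs1
    have hU : IsOpen {x | r * ‖f x‖ < s ^ 2} :=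
      isOpen_lt (continuous_const.mul (map_continuous f).norm) continuous_const
    obtain ⟨g, hg1, hg0, hg⟩ := exists_zeroAtInfty_bump ℂ (isCompact_singleton (x := y)) hU
      (by simpa [hf] using by positivity)
    refine ⟨g, fun c hc => ?_⟩
    have hF : ‖g + c • f‖ ≤ 1 + s ^ 2 := by
      refine ZeroAtInftyContinuousMap.norm_le_of_forall (by positivity) fun x => ?_
      have hcf : ‖c * f x‖ ≤ r * ‖f x‖ := by rw [norm_mul]; gcongr
      rw [ZeroAtInftyContinuousMap.add_apply, ZeroAtInftyContinuousMap.smul_apply, smul_eq_mul]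
      by_cases hx : x ∈ {x | r * ‖f x‖ < s ^ 2}
      · exact (norm_add_le _ _).trans (add_le_add (hg x).2 (hcf.trans (le_of_lt hx)))
      · rw [hg0 x hx, zero_add]
        have h1 : r * ‖f x‖ ≤ r * ‖f‖ := by gcongr; exact f.norm_apply_le x
        nlinarith [sq_nonneg s]
    have hFy : (g + c • f) y = 1 := by simp [hf, hg1 y rfl]
    have hmain : ∀ t : ℝ, t ^ 2 = s ^ 2 →
        -(t * (T (g + c • f) y).im) ≤ (1 + 2 * C) * s ^ 2 := by
      intro t ht
      have h1 := (ZeroAtInftyContinuousMap.norm_apply_le _ y).trans (hT t (g + c • f))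
      have h2 := (Complex.re_le_norm _).trans
        (h1.trans (mul_le_mul_of_nonneg_left hF (by positivity)))
      rw [ZeroAtInftyContinuousMap.add_apply, hFy, ZeroAtInftyContinuousMap.smul_apply,
        smul_eq_mul, mul_assoc, Complex.add_re, Complex.one_re, Complex.re_ofReal_mul,
        Complex.I_mul_re, ht] at h2
      have h3 : s ^ 2 ≤ 1 := by nlinarith
      nlinarith [mul_nonneg hC (sq_nonneg s),
        mul_le_mul_of_nonneg_left h3 (mul_nonneg hC (sq_nonneg s))]
    have h1 := hmain s rfl
    have h2 := hmain (-s) (by ring)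
    have him : (T (g + c • f) y).im = (T g y).im + (c * T f y).im := by simp
    rw [him] at h1 h2
    rw [abs_le]
    constructor <;> nlinarith
  -- The same `g` serves every `c`, so comparison with `c = 0` removes `T g y`. The chosen `s` makes
  -- the combined error at most half of the assumed non-zero value.
  have hzero : ∀ c : ℂ, ‖c‖ ≤ r → (c * T f y).im = 0 := by
    intro c hc
    by_contra hne
    have hpos : 0 < |(c * T f y).im| := abs_pos.2 hne
    set s : ℝ := min 1 (|(c * T f y).im| / (4 * (1 + 2 * C))) with hs
    have hs0 : 0 < s := lt_min one_pos (by positivity)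
    obtain ⟨g, hg⟩ := key s hs0 (min_le_left _ _)
    have h1 := hg 0 (by simpa using hr0.le)
    have h2 := hg c hc
    rw [zero_mul, Complex.zero_im, add_zero] at h1
    have h3 : s * (4 * (1 + 2 * C)) ≤ |(c * T f y).im| :=
      (le_div_iff₀ (by positivity)).1 (min_le_right _ _)
    have h4 : |(c * T f y).im| ≤ 2 * ((1 + 2 * C) * s) := by
      have h5 := abs_sub ((T g y).im + (c * T f y).im) (T g y).im
      rw [add_sub_cancel_left] at h5
      linarith
    nlinarith
  have h1 := hzero r (by simp [abs_of_pos hr0])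
  have h2 := hzero (r * Complex.I) (by simp [abs_of_pos hr0])
  rw [mul_assoc] at h2
  rw [Complex.im_ofReal_mul] at h1 h2
  apply Complex.ext
  · simpa [hr0.ne'] using h2
  · simpa [hr0.ne'] using h1

variable {𝕜 : Type*} [RCLike 𝕜]

/-- The positive part of the real part of a function in `C₀`. -/
def ZeroAtInftyContinuousMap.posRe (a : C₀(Y, 𝕜)) : C₀(Y, 𝕜) where
  toFun x := _root_.posRe (a x)
  continuous_toFun := lipschitzWith_posRe.continuous.comp (map_continuous a)
  zero_at_infty' := (lipschitzWith_posRe.continuous.tendsto' 0 0 posRe_zero).comp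
    (zero_at_infty a)

@[simp] lemma ZeroAtInftyContinuousMap.posRe_apply (a : C₀(Y, 𝕜)) (x : Y) :
    a.posRe x = _root_.posRe (a x) := rfl

lemma ZeroAtInftyContinuousMap.neg_one_smul_eq_neg (a : C₀(Y, 𝕜)) : (-1 : 𝕜) • a = -a := by
  ext x
  simp

lemma ZeroAtInftyContinuousMap.eq_posRe_decomposition (a : C₀(Y, 𝕜)) :
    a = a.posRe - (-a).posRe +
      (RCLike.I : 𝕜) • ((-(RCLike.I : 𝕜) • a).posRe - ((RCLike.I : 𝕜) • a).posRe) := by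
  ext x
  simpa using _root_.eq_posRe_decomposition (a x)

lemma RCLike.norm_I_le_one : ‖(RCLike.I : 𝕜)‖ ≤ 1 := by
  by_cases h : (RCLike.I : 𝕜) = 0
  · simp [h]
  · exact (RCLike.norm_I_of_ne_zero h).le

lemma ZeroAtInftyContinuousMap.norm_posRe_smul_le {c : 𝕜} (hc : ‖c‖ ≤ 1) (a : C₀(Y, 𝕜)) :
    ‖(c • a).posRe‖ ≤ ‖a‖ := by
  refine ZeroAtInftyContinuousMap.norm_le_of_forall (norm_nonneg a) fun x => ?_
  refine (_root_.norm_posRe_le _).trans ?_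
  rw [smul_apply, smul_eq_mul, norm_mul]
  exact (mul_le_of_le_one_left (norm_nonneg _) hc).trans (a.norm_apply_le x)

lemma norm_sub_add_I_mul_sub_le {z₁ z₂ z₃ z₄ : 𝕜} {B : ℝ} (h₁ : ‖z₁‖ ≤ B) (h₂ : ‖z₂‖ ≤ B)
    (h₃ : ‖z₃‖ ≤ B) (h₄ : ‖z₄‖ ≤ B) : ‖z₁ - z₂ + RCLike.I * (z₃ - z₄)‖ ≤ 4 * B :=
  calc ‖z₁ - z₂ + RCLike.I * (z₃ - z₄)‖ ≤ ‖z₁ - z₂‖ + ‖(RCLike.I : 𝕜)‖ * ‖z₃ - z₄‖ := by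
        rw [← norm_mul]; exact norm_add_le _ _
    _ ≤ (‖z₁‖ + ‖z₂‖) + 1 * (‖z₃‖ + ‖z₄‖) := by
        gcongr
        · exact norm_sub_le _ _
        · exact RCLike.norm_I_le_one
        · exact norm_sub_le _ _
    _ ≤ 4 * B := by linarith

lemma norm_le_mul_norm_of_nonneg {z w : 𝕜} {M : ℝ} (hM : 0 ≤ M) (hz : 0 ≤ z)
    (hw : 0 ≤ (M : 𝕜) * w - z) : ‖z‖ ≤ M * ‖w‖ := by
  obtain ⟨r, hr, rfl⟩ := RCLike.nonneg_iff_exists_ofReal.1 hz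
  obtain ⟨s, hs, h⟩ := RCLike.nonneg_iff_exists_ofReal.1 hw
  have h1 : (M : 𝕜) * w = ((r + s : ℝ) : 𝕜) := by
    rw [RCLike.ofReal_add, h]; ring
  have h2 : M * ‖w‖ = r + s := by
    rw [← abs_of_nonneg hM, ← RCLike.norm_ofReal (K := 𝕜), ← norm_mul, h1, RCLike.norm_ofReal,
      abs_of_nonneg (by linarith)]
  rw [h2, RCLike.norm_ofReal, abs_of_nonneg hr]
  linarith

/-- A positive non-degenerate representation satisfies `π a ≤ ‖a‖` for `a ≥ 0`. -/
lemma smul_sub_representation_mem {X : Type*} [TopologicalSpace X] [LocallyCompactSpace X]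
    [T2Space X] {E : Type*} [NormedAddCommGroup E] [NormedSpace 𝕜 E]
    {π : C₀(X, 𝕜) →ₙₐ[𝕜] (E →L[𝕜] E)} (hπ : IsContractive π) (hnd : IsNondegenerate π)
    {P : Set E} (hP : IsClosed P)
    (hpos : ∀ a : C₀(X, 𝕜), (∀ x, 0 ≤ a x) → ∀ ξ ∈ P, π a ξ ∈ P)
    {a : C₀(X, 𝕜)} (ha : ∀ x, 0 ≤ a x) {ξ : E} (hξ : ξ ∈ P) :
    ((‖a‖ : ℝ) : 𝕜) • ξ - π a ξ ∈ P := by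
  obtain ⟨e, he, hlim⟩ := exists_zeroAtInfty_approximateUnit 𝕜 (X := X)
  have ht := tendsto_representation_approximateUnit hπ hnd (fun K x => (he K x).2) hlim
  -- Here `e K * (‖a‖ - a)` is a non-negative element of `C₀(X)`, and `P` is closed under limits.
  have hl : Tendsto (fun K => π (((‖a‖ : ℝ) : 𝕜) • e K - e K * a) ξ) atTop
      (𝓝 (((‖a‖ : ℝ) : 𝕜) • ξ - π a ξ)) := by
    simpa using ((ht ξ).const_smul ((‖a‖ : ℝ) : 𝕜)).sub (ht (π a ξ))
  refine hP.mem_of_tendsto hl (Eventually.of_forall fun K => hpos _ (fun x => ?_) ξ hξ)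
  have h1 : (((‖a‖ : ℝ) : 𝕜) • e K - e K * a) x = e K x * (((‖a‖ : ℝ) : 𝕜) - a x) := by
    rw [ZeroAtInftyContinuousMap.sub_apply, ZeroAtInftyContinuousMap.smul_apply,
      ZeroAtInftyContinuousMap.mul_apply, smul_eq_mul]
    ring
  rw [h1]
  refine mul_nonneg (he K x).1 ?_
  obtain ⟨r, hr, hra⟩ := RCLike.nonneg_iff_exists_ofReal.1 (ha x)
  have h2 : r ≤ ‖a‖ := by
    have := a.norm_apply_le x
    rwa [← hra, RCLike.norm_ofReal, abs_of_nonneg hr] at this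
  rw [← hra, ← RCLike.ofReal_sub]
  exact RCLike.ofReal_nonneg.2 (sub_nonneg.2 h2)

/-- The segment `[0, M]` lies in every disc used in `nonneg_of_forall_norm_le`. -/
lemma norm_add_le_sqrt_of_nonneg {z : ℂ} {M : ℝ} (hz : 0 ≤ z) (hzM : ‖z‖ ≤ M) (s : ℤ) :
    ‖z + (-(M / 2 : ℝ) + (s : ℝ) * Complex.I)‖ ≤ √(M ^ 2 / 4 + s ^ 2) := by
  obtain ⟨r, hr, rfl⟩ := RCLike.nonneg_iff_exists_ofReal.1 hz
  have hrM : r ≤ M := by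
    rwa [RCLike.norm_ofReal, abs_of_nonneg hr] at hzM
  refine Real.le_sqrt_of_sq_le ?_
  rw [← Complex.normSq_eq_norm_sq, Complex.normSq_apply]
  simp
  nlinarith [mul_nonneg hr (sub_nonneg.2 hrM)]

end ContinuousFunctions

/-! ### Positivity and multipliers of representations -/

section Representations

variable {𝕜 : Type*} [RCLike 𝕜] {X : Type*} [TopologicalSpace X] [LocallyCompactSpace X]
  [T2Space X]

section Lp

variable {Ω : Type*} [MeasurableSpace Ω] {μ : Measure Ω} {p : ℝ≥0∞} [Fact (1 ≤ p)]

/-- Complex representations on `L^p`, `p ≠ 2`, are positive. -/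
lemma isPositiveOnLp_of_isContractive (hp : p ≠ 2)
    {π : C₀(X, ℂ) →ₙₐ[ℂ] (Lp ℂ p μ →L[ℂ] Lp ℂ p μ)} (hπ : IsContractive π)
    (hnd : IsNondegenerate π) {a : C₀(X, ℂ)} (ha : ∀ x, 0 ≤ a x) : IsPositiveOnLp (π a) := by
  have hherm : IsHermitianOp (π a) (‖a‖ ^ 2) := fun t ξ =>
    norm_add_smul_representation_le hπ hnd (fun x => (Complex.nonneg_iff.1 (ha x)).2.symm) t ξ
  have hloc : IsLocalOnLp (π a) := hherm.isLocalOnLp hp (by positivity)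
  intro ξ hξ
  -- Each shift `π a + c` is again local, so its norm bound holds pointwise and puts `π a ξ x` in
  -- the scaled disc. Integer `s` keep the null sets countable.
  have hdom : ∀ᵐ x ∂μ, ∀ s : ℤ,
      ‖π a ξ x + (-(‖a‖ / 2 : ℝ) + (s : ℝ) * Complex.I) * ξ x‖ ≤
        √(‖a‖ ^ 2 / 4 + s ^ 2) * ‖ξ x‖ := by
    rw [ae_all_iff]
    intro s
    set c : ℂ := -(‖a‖ / 2 : ℝ) + (s : ℝ) * Complex.I with hc
    have hcoe : ∀ ζ : Lp ℂ p μ, ∀ᵐ x ∂μ,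
        (π a + c • ContinuousLinearMap.id ℂ (Lp ℂ p μ)) ζ x = π a ζ x + c * ζ x := by
      intro ζ
      filter_upwards [Lp.coeFn_add (π a ζ) (c • ζ), Lp.coeFn_smul c ζ] with x h1 h2
      exact h1.trans (by rw [Pi.add_apply, h2]; rfl)
    have hloc' : IsLocalOnLp (π a + c • ContinuousLinearMap.id ℂ (Lp ℂ p μ)) := by
      intro ζ
      filter_upwards [hcoe ζ, hloc ζ] with x h1 h2 h3
      rw [h1, h2 h3, h3, mul_zero, add_zero]
    have h := hloc'.ae_norm_le (Real.sqrt_nonneg (‖a‖ ^ 2 / 4 + s ^ 2)) (fun ζ =>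
      norm_representation_add_smul_le hπ hnd (Real.sqrt_nonneg _)
        (fun x => norm_add_le_sqrt_of_nonneg (ha x) (a.norm_apply_le x) s) ζ) ξ
    filter_upwards [h, hcoe ξ] with x h1 h2
    rwa [h2] at h1
  filter_upwards [hdom, hξ] with x h1 h2
  exact nonneg_of_forall_norm_le (norm_nonneg a) h2 h1

omit [Fact (1 ≤ p)] in
lemma Lp.eq_posRe_decomposition (ξ : Lp 𝕜 p μ) :
    ξ = lipschitzWith_posRe.compLp posRe_zero ξ - lipschitzWith_posRe.compLp posRe_zero (-ξ) +
      (RCLike.I : 𝕜) • (lipschitzWith_posRe.compLp posRe_zero (-(RCLike.I : 𝕜) • ξ) -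
        lipschitzWith_posRe.compLp posRe_zero ((RCLike.I : 𝕜) • ξ)) := by
  refine Lp.ext ?_
  grw [Lp.coeFn_add, Lp.coeFn_smul, Lp.coeFn_sub, Lp.coeFn_sub]
  filter_upwards [lipschitzWith_posRe.coeFn_compLp posRe_zero ξ,
    lipschitzWith_posRe.coeFn_compLp posRe_zero (-ξ),
    lipschitzWith_posRe.coeFn_compLp posRe_zero (-(RCLike.I : 𝕜) • ξ),
    lipschitzWith_posRe.coeFn_compLp posRe_zero ((RCLike.I : 𝕜) • ξ),
    Lp.coeFn_neg ξ, Lp.coeFn_smul (-(RCLike.I : 𝕜)) ξ, Lp.coeFn_smul (RCLike.I : 𝕜) ξ]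
    with x h1 h2 h3 h4 h5 h6 h7
  simp only [Pi.add_apply, Pi.sub_apply, Pi.smul_apply, h1, h2, h3, h4, Function.comp_apply, h5,
    h6, h7, Pi.neg_apply, smul_eq_mul]
  exact _root_.eq_posRe_decomposition (ξ x)

/-- Positive representations on `L^p` consist of pointwise dominated operators. -/
lemma ae_norm_representation_le_of_isPositiveOnLp
    {π : C₀(X, 𝕜) →ₙₐ[𝕜] (Lp 𝕜 p μ →L[𝕜] Lp 𝕜 p μ)} (hπ : IsContractive π)
    (hnd : IsNondegenerate π)
    (hpos : ∀ a : C₀(X, 𝕜), (∀ x, 0 ≤ a x) → IsPositiveOnLp (π a))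
    (a : C₀(X, 𝕜)) (ξ : Lp 𝕜 p μ) : ∀ᵐ x ∂μ, ‖π a ξ x‖ ≤ ‖a‖ * ‖ξ x‖ := by
  have h₁ : ∀ a : C₀(X, 𝕜), (∀ x, 0 ≤ a x) → ∀ ξ : Lp 𝕜 p μ, (∀ᵐ x ∂μ, 0 ≤ ξ x) →
      ∀ᵐ x ∂μ, ‖π a ξ x‖ ≤ ‖a‖ * ‖ξ x‖ := by
    intro a ha ξ hξ
    have h := smul_sub_representation_mem hπ hnd Lp.isClosed_setOf_ae_nonneg hpos ha hξ
    filter_upwards [h, hpos a ha ξ hξ, Lp.coeFn_sub (((‖a‖ : ℝ) : 𝕜) • ξ) (π a ξ),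
      Lp.coeFn_smul ((‖a‖ : ℝ) : 𝕜) ξ] with x h1 h2 h3 h4
    rw [h3, Pi.sub_apply, h4] at h1
    exact norm_le_mul_norm_of_nonneg (norm_nonneg a) h2 h1
  have h₂ : ∀ a : C₀(X, 𝕜), (∀ x, 0 ≤ a x) → ∀ ξ : Lp 𝕜 p μ,
      ∀ᵐ x ∂μ, ‖π a ξ x‖ ≤ 4 * (‖a‖ * ‖ξ x‖) := by
    intro a ha ξ
    have hpart : ∀ c : 𝕜, ‖c‖ ≤ 1 → ∀ᵐ x ∂μ,
        ‖π a (lipschitzWith_posRe.compLp posRe_zero (c • ξ)) x‖ ≤ ‖a‖ * ‖ξ x‖ := by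
      intro c hc
      have hφ := lipschitzWith_posRe.coeFn_compLp posRe_zero (c • ξ)
      have hnn : ∀ᵐ x ∂μ, 0 ≤ lipschitzWith_posRe.compLp posRe_zero (c • ξ) x := by
        filter_upwards [hφ] with x hx
        rw [hx]
        exact posRe_nonneg _
      filter_upwards [h₁ a ha _ hnn, hφ, Lp.coeFn_smul c ξ] with x h1 h2 h3
      refine h1.trans (mul_le_mul_of_nonneg_left ?_ (norm_nonneg a))
      rw [h2, Function.comp_apply, h3, Pi.smul_apply, smul_eq_mul]
      refine (norm_posRe_le _).trans ?_
      rw [norm_mul]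
      exact mul_le_of_le_one_left (norm_nonneg _) hc
    have hdec := congrArg (π a) (Lp.eq_posRe_decomposition ξ)
    rw [map_add, map_sub, map_smul, map_sub] at hdec
    have e₁ := hpart 1 (by simp)
    have e₂ := hpart (-1) (by simp)
    rw [one_smul] at e₁
    rw [neg_one_smul] at e₂
    filter_upwards [e₁, e₂, hpart (-RCLike.I) (by simpa using RCLike.norm_I_le_one),
      hpart RCLike.I RCLike.norm_I_le_one,
      Lp.coeFn_add (π a (lipschitzWith_posRe.compLp posRe_zero ξ) -
        π a (lipschitzWith_posRe.compLp posRe_zero (-ξ)))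
        ((RCLike.I : 𝕜) • (π a (lipschitzWith_posRe.compLp posRe_zero (-(RCLike.I : 𝕜) • ξ)) -
        π a (lipschitzWith_posRe.compLp posRe_zero ((RCLike.I : 𝕜) • ξ)))),
      Lp.coeFn_sub (π a (lipschitzWith_posRe.compLp posRe_zero ξ))
        (π a (lipschitzWith_posRe.compLp posRe_zero (-ξ))),
      Lp.coeFn_smul (RCLike.I : 𝕜)
        (π a (lipschitzWith_posRe.compLp posRe_zero (-(RCLike.I : 𝕜) • ξ)) -
        π a (lipschitzWith_posRe.compLp posRe_zero ((RCLike.I : 𝕜) • ξ))),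
      Lp.coeFn_sub (π a (lipschitzWith_posRe.compLp posRe_zero (-(RCLike.I : 𝕜) • ξ)))
        (π a (lipschitzWith_posRe.compLp posRe_zero ((RCLike.I : 𝕜) • ξ)))]
      with x g₁ g₂ g₃ g₄ k₁ k₂ k₃ k₄
    rw [hdec, k₁, Pi.add_apply, k₂, k₃, Pi.smul_apply, k₄]
    exact norm_sub_add_I_mul_sub_le g₁ g₂ g₃ g₄
  have h₃ : ∀ a : C₀(X, 𝕜), ∀ ξ : Lp 𝕜 p μ, ∀ᵐ x ∂μ, ‖π a ξ x‖ ≤ 16 * ‖a‖ * ‖ξ x‖ := by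
    intro a ξ
    have hpart : ∀ c : 𝕜, ‖c‖ ≤ 1 → ∀ᵐ x ∂μ,
        ‖π (c • a).posRe ξ x‖ ≤ 4 * (‖a‖ * ‖ξ x‖) := by
      intro c hc
      filter_upwards [h₂ (c • a).posRe (fun x => posRe_nonneg _) ξ] with x hx
      refine hx.trans ?_
      gcongr
      exact ZeroAtInftyContinuousMap.norm_posRe_smul_le hc a
    have hdec := congrArg (fun b => π b ξ) a.eq_posRe_decomposition
    simp only [map_add, map_sub, map_smul, add_apply,
      sub_apply, _root_.smul_apply] at hdec
    have e₁ := hpart 1 (by simp)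
    have e₂ := hpart (-1) (by simp)
    rw [one_smul] at e₁
    rw [ZeroAtInftyContinuousMap.neg_one_smul_eq_neg] at e₂
    filter_upwards [e₁, e₂, hpart (-RCLike.I) (by simpa using RCLike.norm_I_le_one),
      hpart RCLike.I RCLike.norm_I_le_one,
      Lp.coeFn_add (π a.posRe ξ - π (-a).posRe ξ) ((RCLike.I : 𝕜) •
        (π (-(RCLike.I : 𝕜) • a).posRe ξ - π ((RCLike.I : 𝕜) • a).posRe ξ)),
      Lp.coeFn_sub (π a.posRe ξ) (π (-a).posRe ξ),
      Lp.coeFn_smul (RCLike.I : 𝕜)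
        (π (-(RCLike.I : 𝕜) • a).posRe ξ - π ((RCLike.I : 𝕜) • a).posRe ξ),
      Lp.coeFn_sub (π (-(RCLike.I : 𝕜) • a).posRe ξ) (π ((RCLike.I : 𝕜) • a).posRe ξ)]
      with x g₁ g₂ g₃ g₄ k₁ k₂ k₃ k₄
    rw [hdec, k₁, Pi.add_apply, k₂, k₃, Pi.smul_apply, k₄]
    refine (norm_sub_add_I_mul_sub_le g₁ g₂ g₃ g₄).trans (le_of_eq (by ring))
  -- The two four-term splittings cost a factor `16`. Locality survives it and recovers the sharp
  -- constant from the operator norm.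
  have hloc : IsLocalOnLp (π a) := fun ζ => by
    filter_upwards [h₃ a ζ] with x hx h0
    simpa [h0] using hx
  exact hloc.ae_norm_le (norm_nonneg a) (fun ζ => (π a).le_of_opNorm_le (hπ a) ζ) ξ

/-- Positive representations on `L^p` of a localizable measure act by multiplication operators. -/
lemma exists_multiplier_representation_Lp (hμ : IsLocalizable μ)
    {π : C₀(X, 𝕜) →ₙₐ[𝕜] (Lp 𝕜 p μ →L[𝕜] Lp 𝕜 p μ)} (hπ : IsContractive π)
    (hnd : IsNondegenerate π)
    (hpos : ∀ a : C₀(X, 𝕜), (∀ x, 0 ≤ a x) → IsPositiveOnLp (π a)) :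
    ∃ π₀ : C₀(X, 𝕜) →ₗ[𝕜] Lp 𝕜 ∞ μ,
      (∀ a b : C₀(X, 𝕜), ∀ᵐ x ∂μ, π₀ (a * b) x = π₀ a x * π₀ b x) ∧
      IsContractive π₀ ∧
      ∀ (a : C₀(X, 𝕜)) (ξ : Lp 𝕜 p μ), ∀ᵐ x ∂μ, (π a ξ) x = π₀ a x * ξ x := by
  choose h hnorm hmul using fun a => hμ.exists_multiplier (norm_nonneg a)
    (ae_norm_representation_le_of_isPositiveOnLp hπ hnd hpos a)
  refine ⟨⟨⟨h, fun a b => ?_⟩, fun c a => ?_⟩, fun a b => ?_, hnorm, hmul⟩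
  -- The algebraic laws of `π₀` follow from those of `π` by uniqueness of multipliers.
  · refine hμ.multiplier_unique (p := p) fun ξ => ?_
    have hab := hmul (a + b) ξ
    rw [map_add, add_apply] at hab
    filter_upwards [hab, hmul a ξ, hmul b ξ, Lp.coeFn_add (π a ξ) (π b ξ),
      Lp.coeFn_add (h a) (h b)] with x h1 h2 h3 h4 h5
    rw [← h1, h4, h5, Pi.add_apply, Pi.add_apply, h2, h3, add_mul]
  · refine hμ.multiplier_unique (p := p) fun ξ => ?_
    have hca := hmul (c • a) ξ
    rw [map_smul, smul_apply] at hca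
    filter_upwards [hca, hmul a ξ, Lp.coeFn_smul c (π a ξ), Lp.coeFn_smul c (h a)]
      with x h1 h2 h3 h4
    rw [RingHom.id_apply, ← h1, h3, h4, Pi.smul_apply, Pi.smul_apply, h2, smul_eq_mul,
      smul_eq_mul, mul_assoc]
  · have hprod : MemLp (fun x => h a x * h b x) ∞ μ := by
      exact (Lp.memLp (h b)).mul (Lp.memLp (h a))
    have heq : h (a * b) = hprod.toLp := by
      refine hμ.multiplier_unique (p := p) fun ξ => ?_
      have hab := hmul (a * b) ξ
      rw [map_mul, mul_apply_eq_comp] at hab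
      filter_upwards [hab, hmul a (π b ξ), hmul b ξ, hprod.coeFn_toLp] with x h1 h2 h3 h4
      rw [← h1, h2, h3, h4, mul_assoc]
    have hcoe := hprod.coeFn_toLp
    rw [← heq] at hcoe
    exact hcoe

end Lp

section ZeroAtInfty

variable {Y : Type*} [TopologicalSpace Y]

/-- Complex representations on `C₀(Y)` are positive. -/
lemma isPositiveOnC0_of_isContractive [LocallyCompactSpace Y] [T2Space Y]
    {π : C₀(X, ℂ) →ₙₐ[ℂ] (C₀(Y, ℂ) →L[ℂ] C₀(Y, ℂ))} (hπ : IsContractive π)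
    (hnd : IsNondegenerate π) {a : C₀(X, ℂ)} (ha : ∀ x, 0 ≤ a x) : IsPositiveOnC0 (π a) := by
  have hherm : IsHermitianOp (π a) (‖a‖ ^ 2) := fun t ξ =>
    norm_add_smul_representation_le hπ hnd (fun x => (Complex.nonneg_iff.1 (ha x)).2.symm) t ξ
  intro ξ hξ y
  refine nonneg_of_forall_norm_le (norm_nonneg a) (hξ y) fun s => ?_
  obtain ⟨g, hg1, -, hg⟩ := exists_zeroAtInfty_bump ℂ (isCompact_singleton (x := y)) isOpen_univ
    (Set.subset_univ _)
  have hgy : g y = 1 := hg1 y rfl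
  have hgn : ‖g‖ ≤ 1 := ZeroAtInftyContinuousMap.norm_le_of_forall zero_le_one fun x => (hg x).2
  -- Locality at `y` applied to `ξ - ξ y • g` reduces the claim to the scalar `π a g y`.
  have hTξ : π a ξ y = ξ y * π a g y := by
    have h := hherm.apply_eq_zero_of_apply_eq_zero (by positivity) (f := ξ - ξ y • g) (y := y)
      (by simp [hgy])
    rw [map_sub, map_smul] at h
    exact sub_eq_zero.1 h
  set c : ℂ := -(‖a‖ / 2 : ℝ) + (s : ℝ) * Complex.I with hc
  have h1 := norm_representation_add_smul_le hπ hnd (Real.sqrt_nonneg _)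
    (fun x => norm_add_le_sqrt_of_nonneg (ha x) (a.norm_apply_le x) s) g
  have h2 : ‖π a g y + c‖ ≤ √(‖a‖ ^ 2 / 4 + s ^ 2) := by
    have h3 := (ZeroAtInftyContinuousMap.norm_apply_le _ y).trans
      (h1.trans (mul_le_of_le_one_right (Real.sqrt_nonneg _) hgn))
    rwa [ZeroAtInftyContinuousMap.add_apply, ZeroAtInftyContinuousMap.smul_apply, hgy,
      smul_eq_mul, mul_one] at h3
  have h4 : π a ξ y + c * ξ y = (π a g y + c) * ξ y := by rw [hTξ]; ring
  rw [h4, norm_mul]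
  gcongr

/-- Positive representations on `C₀(Y)` consist of pointwise dominated operators. -/
lemma norm_representation_apply_le_of_isPositiveOnC0
    {π : C₀(X, 𝕜) →ₙₐ[𝕜] (C₀(Y, 𝕜) →L[𝕜] C₀(Y, 𝕜))} (hπ : IsContractive π)
    (hnd : IsNondegenerate π)
    (hpos : ∀ a : C₀(X, 𝕜), (∀ x, 0 ≤ a x) → IsPositiveOnC0 (π a))
    (a : C₀(X, 𝕜)) (ξ : C₀(Y, 𝕜)) (y : Y) : ‖π a ξ y‖ ≤ 16 * ‖a‖ * ‖ξ y‖ := by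
  have hcl : IsClosed {ξ : C₀(Y, 𝕜) | ∀ x, 0 ≤ ξ x} := by
    have h : {ξ : C₀(Y, 𝕜) | ∀ x, 0 ≤ ξ x} = {ξ : C₀(Y, 𝕜) | ∀ x, posRe (ξ x) = ξ x} := by
      ext ξ
      exact forall_congr' fun x => ⟨posRe_eq_self, fun h => h ▸ posRe_nonneg _⟩
    rw [h, Set.ofPred_forall]
    refine isClosed_iInter fun x => ?_
    have hev : Continuous fun ξ : C₀(Y, 𝕜) => ξ x :=
      (BoundedContinuousFunction.lipschitz_eval_const x).continuous.comp
        ZeroAtInftyContinuousMap.isometry_toBCF.continuous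
    exact isClosed_eq (lipschitzWith_posRe.continuous.comp hev) hev
  have h₁ : ∀ a : C₀(X, 𝕜), (∀ x, 0 ≤ a x) → ∀ ξ : C₀(Y, 𝕜), (∀ x, 0 ≤ ξ x) →
      ‖π a ξ y‖ ≤ ‖a‖ * ‖ξ y‖ := by
    intro a ha ξ hξ
    have h := smul_sub_representation_mem hπ hnd hcl hpos ha hξ
    exact norm_le_mul_norm_of_nonneg (norm_nonneg a) (hpos a ha ξ hξ y) (h y)
  -- The constants `4` and then `16` are harmless: the bound serves to show that `π a ξ` vanishes
  -- where `ξ` does.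
  have h₂ : ∀ a : C₀(X, 𝕜), (∀ x, 0 ≤ a x) → ∀ ξ : C₀(Y, 𝕜),
      ‖π a ξ y‖ ≤ 4 * (‖a‖ * ‖ξ y‖) := by
    intro a ha ξ
    have hpart : ∀ c : 𝕜, ‖c‖ ≤ 1 → ‖π a (c • ξ).posRe y‖ ≤ ‖a‖ * ‖ξ y‖ := by
      intro c hc
      refine (h₁ a ha _ fun x => posRe_nonneg _).trans
        (mul_le_mul_of_nonneg_left ?_ (norm_nonneg a))
      refine (norm_posRe_le _).trans ?_
      rw [ZeroAtInftyContinuousMap.smul_apply, smul_eq_mul, norm_mul]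
      exact mul_le_of_le_one_left (norm_nonneg _) hc
    have hdec := congrArg (fun ζ => π a ζ y) ξ.eq_posRe_decomposition
    simp only [map_add, map_sub, map_smul] at hdec
    have e₁ := hpart 1 (by simp)
    have e₂ := hpart (-1) (by simp)
    rw [one_smul] at e₁
    rw [ZeroAtInftyContinuousMap.neg_one_smul_eq_neg] at e₂
    rw [hdec]
    exact norm_sub_add_I_mul_sub_le e₁ e₂
      (hpart (-RCLike.I) (by simpa using RCLike.norm_I_le_one))
      (hpart RCLike.I RCLike.norm_I_le_one)
  have hpart : ∀ c : 𝕜, ‖c‖ ≤ 1 → ‖π (c • a).posRe ξ y‖ ≤ 4 * (‖a‖ * ‖ξ y‖) := by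
    intro c hc
    refine (h₂ (c • a).posRe (fun x => posRe_nonneg _) ξ).trans ?_
    gcongr
    exact ZeroAtInftyContinuousMap.norm_posRe_smul_le hc a
  have hdec := congrArg (fun b => π b ξ y) a.eq_posRe_decomposition
  simp only [map_add, map_sub, map_smul] at hdec
  have e₁ := hpart 1 (by simp)
  have e₂ := hpart (-1) (by simp)
  rw [one_smul] at e₁
  rw [ZeroAtInftyContinuousMap.neg_one_smul_eq_neg] at e₂
  rw [hdec]
  exact (norm_sub_add_I_mul_sub_le e₁ e₂
    (hpart (-RCLike.I) (by simpa using RCLike.norm_I_le_one))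
    (hpart RCLike.I RCLike.norm_I_le_one)).trans (le_of_eq (by ring))

/-- Positive representations on `C₀(Y)` act by multiplication operators. -/
lemma exists_multiplier_representation_zeroAtInfty [LocallyCompactSpace Y] [T2Space Y]
    {π : C₀(X, 𝕜) →ₙₐ[𝕜] (C₀(Y, 𝕜) →L[𝕜] C₀(Y, 𝕜))} (hπ : IsContractive π)
    (hnd : IsNondegenerate π)
    (hpos : ∀ a : C₀(X, 𝕜), (∀ x, 0 ≤ a x) → IsPositiveOnC0 (π a)) :
    ∃ π₀ : C₀(X, 𝕜) →ₙₐ[𝕜] (Y →ᵇ 𝕜), IsContractive π₀ ∧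
      ∀ (a : C₀(X, 𝕜)) (ξ : C₀(Y, 𝕜)) (x : Y), (π a ξ) x = π₀ a x * ξ x := by
  -- Since `g y` is `1` on a whole neighbourhood of `y`, the multiplier agrees there with the
  -- continuous function `π a (g y)`; its norm bound gives contractivity.
  have hg : ∀ y : Y, ∃ g : C₀(Y, 𝕜), (∀ᶠ z in 𝓝 y, g z = 1) ∧ ‖g‖ ≤ 1 := by
    intro y
    obtain ⟨K, hK, hyK⟩ := exists_compact_mem_nhds y
    obtain ⟨g, hg1, -, hg⟩ := exists_zeroAtInfty_bump 𝕜 hK isOpen_univ (Set.subset_univ _)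
    exact ⟨g, mem_of_superset hyK hg1, ZeroAtInftyContinuousMap.norm_le_of_forall zero_le_one
      fun x => (hg x).2⟩
  choose g hg1 hgn using hg
  have hmul : ∀ (a : C₀(X, 𝕜)) (ξ : C₀(Y, 𝕜)) (y : Y), π a ξ y = π a (g y) y * ξ y := by
    intro a ξ y
    have h := norm_representation_apply_le_of_isPositiveOnC0 hπ hnd hpos a (ξ - ξ y • g y) y
    have h0 : (ξ - ξ y • g y) y = 0 := by simp [(hg1 y).self_of_nhds]
    rw [h0, norm_zero, mul_zero, norm_le_zero_iff, map_sub, map_smul,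
      ZeroAtInftyContinuousMap.sub_apply, ZeroAtInftyContinuousMap.smul_apply, sub_eq_zero,
      smul_eq_mul] at h
    rw [h, mul_comm]
  have hcont : ∀ a : C₀(X, 𝕜), Continuous fun y => π a (g y) y := by
    intro a
    rw [continuous_iff_continuousAt]
    intro y
    refine (map_continuous (π a (g y))).continuousAt.congr ?_
    filter_upwards [hg1 y] with z hz
    rw [hmul a (g y) z, hz, mul_one]
  have hbound : ∀ (a : C₀(X, 𝕜)) (y : Y), ‖π a (g y) y‖ ≤ ‖a‖ := by
    intro a y
    refine (ZeroAtInftyContinuousMap.norm_apply_le _ y).trans ?_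
    exact ((π a).le_of_opNorm_le (hπ a) (g y)).trans
      (mul_le_of_le_one_right (norm_nonneg a) (hgn y))
  refine ⟨{ toFun := fun a => BoundedContinuousFunction.ofNormedAddCommGroup
              (fun y => π a (g y) y) (hcont a) ‖a‖ (hbound a)
            map_smul' := fun c a => ?_
            map_zero' := ?_
            map_add' := fun a b => ?_
            map_mul' := fun a b => ?_ }, fun a => ?_, hmul⟩
  · ext y
    simp
  · ext y
    simp
  · ext y
    simp
  · ext y
    have h := hmul a (π b (g y)) y
    simpa using h
  · exact BoundedContinuousFunction.norm_ofNormedAddCommGroup_le _ (norm_nonneg a) (hbound a)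

end ZeroAtInfty

end Representations

end

theorem mainTheorem6 {X : Type*} [TopologicalSpace X] [LocallyCompactSpace X] [T2Space X]
    {Ω : Type*} [MeasurableSpace Ω] (μ : Measure Ω) (hμ : IsLocalizable μ)
    (p : ℝ≥0∞) [Fact (1 ≤ p)] (hp : p ≠ 2)
    {Y : Type*} [TopologicalSpace Y] [LocallyCompactSpace Y] [T2Space Y]
    (𝕜 : Type*) [RCLike 𝕜] :
    -- complex scalars, `E = L^p(μ)`: positivity is automatic
    (∀ π : C₀(X, ℂ) →ₙₐ[ℂ] (Lp ℂ p μ →L[ℂ] Lp ℂ p μ),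
      IsContractive π → IsNondegenerate π →
        ∀ a : C₀(X, ℂ), (∀ x, 0 ≤ a x) → IsPositiveOnLp (π a)) ∧
    -- real or complex scalars, `E = L^p(μ)`: positive implies multiplication operators
    (∀ π : C₀(X, 𝕜) →ₙₐ[𝕜] (Lp 𝕜 p μ →L[𝕜] Lp 𝕜 p μ),
      IsContractive π → IsNondegenerate π →
        (∀ a : C₀(X, 𝕜), (∀ x, 0 ≤ a x) → IsPositiveOnLp (π a)) →
        -- `π₀` is a contractive algebra homomorphism into `L^∞(μ)`
        ∃ π₀ : C₀(X, 𝕜) →ₗ[𝕜] Lp 𝕜 ∞ μ,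
          (∀ a b : C₀(X, 𝕜), ∀ᵐ x ∂μ, π₀ (a * b) x = π₀ a x * π₀ b x) ∧
          IsContractive π₀ ∧
          ∀ (a : C₀(X, 𝕜)) (ξ : Lp 𝕜 p μ), ∀ᵐ x ∂μ, (π a ξ) x = π₀ a x * ξ x) ∧
    -- complex scalars, `E = C_0(Y)`: positivity is automatic
    (∀ π : C₀(X, ℂ) →ₙₐ[ℂ] (C₀(Y, ℂ) →L[ℂ] C₀(Y, ℂ)),
      IsContractive π → IsNondegenerate π →
        ∀ a : C₀(X, ℂ), (∀ x, 0 ≤ a x) → IsPositiveOnC0 (π a)) ∧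
    -- real or complex scalars, `E = C_0(Y)`: positive implies multiplication operators
    (∀ π : C₀(X, 𝕜) →ₙₐ[𝕜] (C₀(Y, 𝕜) →L[𝕜] C₀(Y, 𝕜)),
      IsContractive π → IsNondegenerate π →
        (∀ a : C₀(X, 𝕜), (∀ x, 0 ≤ a x) → IsPositiveOnC0 (π a)) →
        ∃ π₀ : C₀(X, 𝕜) →ₙₐ[𝕜] (Y →ᵇ 𝕜), IsContractive π₀ ∧
          ∀ (a : C₀(X, 𝕜)) (ξ : C₀(Y, 𝕜)) (x : Y), (π a ξ) x = π₀ a x * ξ x) := by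
  exact ⟨fun π hπ hnd a ha => isPositiveOnLp_of_isContractive hp hπ hnd ha,
    fun π hπ hnd hpos => exists_multiplier_representation_Lp hμ hπ hnd hpos,
    fun π hπ hnd a ha => isPositiveOnC0_of_isContractive hπ hnd ha,
    fun π hπ hnd hpos => exists_multiplier_representation_zeroAtInfty hπ hnd hpos⟩
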